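/- **Theories.** All theories use classical predicate logic with equality; a formula is *provable* in a theory if it has a formal proof from the axioms of the theory in which only formulas of its language occur (free variables in axioms are read universally). $\mathbf{PA}$ is first-order Peano Arithmetic: its function identifiers are $0,\mathtt s,+,\cdot$, and its axioms are $\mathtt s(x)\neq 0$, $\;\mathtt s(x)=\mathtt s(y)\to x=y$, the recursion equations for $+$ and $\cdot$, and induction for all formulas of its language. $\mathbf{PRA}$ is the first-order theory with a function identifier for every primitive recursive function (one for each way of generating it from zero, successor and projections by composition and primitive recursion). Its axioms are $\mathtt s(x)\neq 0$, $\;\mathtt s(x)=\mathtt s(y)\to x=y$, the defining equations of all primitive recursive functions, and induction for **all** formulas of its language. The language of $\mathbf{PA}$ is regarded as part of that of $\mathbf{PRA}$, $+$ and $\cdot$ being the identifiers given by their usual recursion equations. $\mathbf{PRA}^*$ is $\mathbf{PRA}$ augmented with variables for numeric functions of every arity, quantifiers over these, equations between functions, and free (never quantified) variables for functionals, which take numeric functions to a numeric function. Terms are built by type-correct application from number, function and functional variables and the identifiers of primitive recursive functions. Besides the axioms of $\mathbf{PRA}$, with induction now for all formulas of the extended language, it has the Principle of Explicit Definition: for each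 term $\mathbf t[\vec x,\vec f]$ of number type, $$\forall \vec f\;\exists g\;\forall\vec x\;\; g(\vec x)=\mathbf t[\vec x,\vec f].$$ **Lemma.** 1. $\mathbf{PRA}^*$ is conservative over $\mathbf{PRA}$: every formula in the language of $\mathbf{PRA}$ that is provable in $\mathbf{PRA}^*$ is provable in $\mathbf{PRA}$. 2. Consequently, $\mathbf{PRA}^*$ is proof-theoretically no stronger than $\mathbf{PA}$: every formula in the language of $\mathbf{PA}$ that is provable in $\mathbf{PRA}^*$ is provable in $\mathbf{PA}$ (in particular, if $\mathbf{PA}$ is consistent then so is $\mathbf{PRA}^*$). Both hold whether or not $\mathbf{PRA}^*$ also includes the axioms of extensionality, $\forall\vec x\,(f(\vec x)=g(\vec x))\to f=g$. -/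

import Mathlib

namespace Arith

/-! ### Vocabulary and syntax -/

/-- Identifiers for the primitive recursive functions of each arity: one for every way of
generating a function from zero, successor and projections by composition and primitive
recursion.  In `prec f g` the recursion argument comes first. -/
inductive PR : ℕ → Type
  | zero : PR 0
  | succ : PR 1
  | proj {n : ℕ} (i : Fin n) : PR n
  | comp {m n : ℕ} (f : PR m) (g : Fin m → PR n) : PR n
  | prec {n : ℕ} (f : PR n) (g : PR (n + 2)) : PR (n + 1)

/-- Terms denoting `k`-ary numeric functions: function variables, identifiers of primitive
recursive functions, and functional variables applied to terms for functions.
`fnl a b n args` is the `n`-th variable for functionals that take functions of arities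
`a 0, …, a (r - 1)` to a function of arity `b`; there are no quantifiers over these.
Function variables are de Bruijn indices, counted separately for each arity. -/
inductive FTm : ℕ → Type
  | var (k : ℕ) (n : ℕ) : FTm k
  | pr {k : ℕ} (c : PR k) : FTm k
  | fnl {r : ℕ} (a : Fin r → ℕ) (b : ℕ) (n : ℕ) (args : ∀ i, FTm (a i)) : FTm b

/-- Terms denoting numbers: number variables (de Bruijn indices) and applications of a
term for a function to terms for numbers. -/
inductive NTm : Type
  | var (n : ℕ) : NTm
  | app {k : ℕ} (f : FTm k) (args : Fin k → NTm) : NTm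

/-- Formulas.  `all` quantifies over numbers and binds number variable `0`; `fall k` quantifies
over `k`-ary functions and binds the `k`-ary function variable `0`. -/
inductive Fml : Type
  | eq (s t : NTm) : Fml
  | feq {k : ℕ} (f g : FTm k) : Fml
  | bot : Fml
  | imp (φ ψ : Fml) : Fml
  | all (φ : Fml) : Fml
  | fall (k : ℕ) (φ : Fml) : Fml

namespace NTm

/-- The numeral `0`. -/
def zero : NTm := app (FTm.pr PR.zero) ![]

/-- The successor of a term. -/
def succ (t : NTm) : NTm := app (FTm.pr PR.succ) ![t]

end NTm

namespace Fml

/-- Negation. -/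
def neg (φ : Fml) : Fml := imp φ bot

/-- Existential quantification over `k`-ary functions (classically). -/
def fex (k : ℕ) (φ : Fml) : Fml := neg (fall k (neg φ))

/-- `∀ x₀ … xₖ₋₁ φ`, binding the number variables `0, …, k - 1`. -/
def alls : ℕ → Fml → Fml
  | 0, φ => φ
  | k + 1, φ => all (alls k φ)

end Fml

/-! ### Substitution

A substitution consists of a term for every number variable and a term for every function
variable.  Terms for functions contain no number variables. -/

/-- Substitution for function variables in a term for a function. -/
def FTm.subst (τ : ∀ k, ℕ → FTm k) : {k : ℕ} → FTm k → FTm k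
  | _, .var k n => τ k n
  | _, .pr c => .pr c
  | _, .fnl a b n args => .fnl a b n (fun i => (args i).subst τ)

/-- Simultaneous substitution in a term for a number. -/
def NTm.subst (σ : ℕ → NTm) (τ : ∀ k, ℕ → FTm k) : NTm → NTm
  | .var n => σ n
  | .app f args => .app (f.subst τ) (fun i => (args i).subst σ τ)

/-- The renaming that frees number variable `0`. -/
def shiftN : ℕ → NTm := fun n => NTm.var (n + 1)

/-- The renaming that frees the `k`-ary function variable `0`. -/
def shiftF (k : ℕ) : ∀ j, ℕ → FTm j := fun j n => FTm.var j (if j = k then n + 1 else n)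

/-- The number part of a substitution, pushed under a number quantifier. -/
def upN (σ : ℕ → NTm) : ℕ → NTm
  | 0 => NTm.var 0
  | n + 1 => (σ n).subst shiftN FTm.var

/-- The function part of a substitution, pushed under a quantifier over `k`-ary functions. -/
def upF (k : ℕ) (τ : ∀ j, ℕ → FTm j) : ∀ j, ℕ → FTm j := fun j n =>
  if j = k then
    match n with
    | 0 => FTm.var j 0
    | m + 1 => (τ j m).subst (shiftF k)
  else (τ j n).subst (shiftF k)

/-- Simultaneous capture-avoiding substitution in a formula. -/
def Fml.subst : (ℕ → NTm) → (∀ k, ℕ → FTm k) → Fml → Fml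
  | σ, τ, .eq s t => .eq (s.subst σ τ) (t.subst σ τ)
  | _, τ, .feq f g => .feq (f.subst τ) (g.subst τ)
  | _, _, .bot => .bot
  | σ, τ, .imp φ ψ => .imp (φ.subst σ τ) (ψ.subst σ τ)
  | σ, τ, .all φ => .all (φ.subst (upN σ) τ)
  | σ, τ, .fall k φ => .fall k (φ.subst (fun n => (σ n).subst NTm.var (shiftF k)) (upF k τ))

namespace Fml

/-- `φ` with all free number variables renamed from `n` to `n + 1`. -/
def liftN (φ : Fml) : Fml := φ.subst shiftN FTm.var

/-- `φ` with all free `k`-ary function variables renamed from `n` to `n + 1`. -/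
def liftF (k : ℕ) (φ : Fml) : Fml := φ.subst NTm.var (shiftF k)

/-- `φ[t]`: the term `t` for number variable `0`, all others renamed from `n + 1` to `n`. -/
def instN (φ : Fml) (t : NTm) : Fml :=
  φ.subst (fun n => match n with
    | 0 => t
    | m + 1 => NTm.var m) FTm.var

/-- `φ[f]`: the term `f` for the `k`-ary function variable `0`, all other `k`-ary function
variables renamed from `n + 1` to `n`. -/
def instF {k : ℕ} (φ : Fml) (f : FTm k) : Fml :=
  φ.subst NTm.var (fun j n =>
    if h : j = k then
      match n with
      | 0 => h ▸ f
      | m + 1 => FTm.var j m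
    else FTm.var j n)

/-- `φ[S x]`, where `x` is number variable `0`, which stays free. -/
def stepN (φ : Fml) : Fml :=
  φ.subst (fun n => match n with
    | 0 => NTm.succ (NTm.var 0)
    | m + 1 => NTm.var (m + 1)) FTm.var

end Fml

/-! ### Languages -/

/-- A language: the admitted function identifiers, and whether function variables, functional
variables, function quantifiers and equations between functions are admitted. -/
structure Lang where
  fn : ∀ {k : ℕ}, PR k → Prop
  higher : Prop

/-- The term belongs to the language. -/
def FTm.InLang (L : Lang) : {k : ℕ} → FTm k → Prop
  | _, .var _ _ => L.higher
  | _, .pr c => L.fn c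
  | _, .fnl _ _ _ args => L.higher ∧ ∀ i, (args i).InLang L

/-- The term belongs to the language. -/
def NTm.InLang (L : Lang) : NTm → Prop
  | .var _ => True
  | .app f args => f.InLang L ∧ ∀ i, (args i).InLang L

/-- The formula belongs to the language. -/
def Fml.InLang (L : Lang) : Fml → Prop
  | .eq s t => s.InLang L ∧ t.InLang L
  | .feq f g => L.higher ∧ f.InLang L ∧ g.InLang L
  | .bot => True
  | .imp φ ψ => φ.InLang L ∧ ψ.InLang L
  | .all φ => φ.InLang L
  | .fall _ φ => L.higher ∧ φ.InLang L

/-! ### Provability -/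

/-- `Provable L Ax φ`: there is a proof of `φ` in classical (many-sorted) predicate logic with
equality from the non-logical axioms `Ax`, in which only formulas of the language `L` occur.
Free variables in axioms are read universally, by the rules of generalization. -/
inductive Provable (L : Lang) (Ax : Set Fml) : Fml → Prop
  | ax {φ : Fml} : φ ∈ Ax → φ.InLang L → Provable L Ax φ
  | mp {φ ψ : Fml} : Provable L Ax (.imp φ ψ) → Provable L Ax φ → Provable L Ax ψ
  | imp_const {φ ψ : Fml} : (Fml.imp φ (.imp ψ φ)).InLang L →
      Provable L Ax (.imp φ (.imp ψ φ))
  | imp_dist {φ ψ χ : Fml} :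
      (Fml.imp (.imp φ (.imp ψ χ)) (.imp (.imp φ ψ) (.imp φ χ))).InLang L →
      Provable L Ax (.imp (.imp φ (.imp ψ χ)) (.imp (.imp φ ψ) (.imp φ χ)))
  | dne {φ : Fml} : (Fml.imp (.neg (.neg φ)) φ).InLang L →
      Provable L Ax (.imp (.neg (.neg φ)) φ)
  | gen {φ : Fml} : Provable L Ax φ → Provable L Ax (.all φ)
  | all_dist {φ ψ : Fml} :
      (Fml.imp (.all (.imp φ ψ)) (.imp (.all φ) (.all ψ))).InLang L →
      Provable L Ax (.imp (.all (.imp φ ψ)) (.imp (.all φ) (.all ψ)))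
  | all_vac {φ : Fml} : (Fml.imp φ (.all φ.liftN)).InLang L →
      Provable L Ax (.imp φ (.all φ.liftN))
  | all_inst {φ : Fml} {t : NTm} : (Fml.imp (.all φ) (φ.instN t)).InLang L →
      Provable L Ax (.imp (.all φ) (φ.instN t))
  | fgen {k : ℕ} {φ : Fml} : L.higher → Provable L Ax φ → Provable L Ax (.fall k φ)
  | fall_dist {k : ℕ} {φ ψ : Fml} :
      (Fml.imp (.fall k (.imp φ ψ)) (.imp (.fall k φ) (.fall k ψ))).InLang L →
      Provable L Ax (.imp (.fall k (.imp φ ψ)) (.imp (.fall k φ) (.fall k ψ)))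
  | fall_vac {k : ℕ} {φ : Fml} : (Fml.imp φ (.fall k (φ.liftF k))).InLang L →
      Provable L Ax (.imp φ (.fall k (φ.liftF k)))
  | fall_inst {k : ℕ} {φ : Fml} {f : FTm k} : (Fml.imp (.fall k φ) (φ.instF f)).InLang L →
      Provable L Ax (.imp (.fall k φ) (φ.instF f))
  | eq_refl {t : NTm} : (Fml.eq t t).InLang L → Provable L Ax (.eq t t)
  | eq_subst {φ : Fml} {s t : NTm} :
      (Fml.imp (.eq s t) (.imp (φ.instN s) (φ.instN t))).InLang L →
      Provable L Ax (.imp (.eq s t) (.imp (φ.instN s) (φ.instN t)))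
  | feq_refl {k : ℕ} {f : FTm k} : (Fml.feq f f).InLang L → Provable L Ax (.feq f f)
  | feq_subst {k : ℕ} {φ : Fml} {f g : FTm k} :
      (Fml.imp (.feq f g) (.imp (φ.instF f) (φ.instF g))).InLang L →
      Provable L Ax (.imp (.feq f g) (.imp (φ.instF f) (φ.instF g)))

/-! ### Non-logical axioms -/

/-- Zero is not a successor, and the successor is injective. -/
inductive separation : Set Fml
  | succ_ne_zero (t : NTm) : separation (.neg (.eq t.succ .zero))
  | succ_inj (s t : NTm) : separation (.imp (.eq s.succ t.succ) (.eq s t))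

/-- The schema of induction. -/
inductive induction : Set Fml
  | intro (φ : Fml) :
      induction (.imp (φ.instN .zero) (.imp (.all (.imp φ φ.stepN)) (.all φ)))

/-- The defining equations of the primitive recursive functions. -/
inductive definingEquations : Set Fml
  | proj {n : ℕ} (i : Fin n) (x : Fin n → NTm) :
      definingEquations (.eq (.app (.pr (.proj i)) x) (x i))
  | comp {m n : ℕ} (f : PR m) (g : Fin m → PR n) (x : Fin n → NTm) :
      definingEquations
        (.eq (.app (.pr (.comp f g)) x) (.app (.pr f) (fun i => .app (.pr (g i)) x)))
  | prec_zero {n : ℕ} (f : PR n) (g : PR (n + 2)) (x : Fin n → NTm) :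
      definingEquations
        (.eq (.app (.pr (.prec f g)) (Matrix.vecCons .zero x)) (.app (.pr f) x))
  | prec_succ {n : ℕ} (f : PR n) (g : PR (n + 2)) (y : NTm) (x : Fin n → NTm) :
      definingEquations
        (.eq (.app (.pr (.prec f g)) (Matrix.vecCons y.succ x))
          (.app (.pr g) (Matrix.vecCons y
            (Matrix.vecCons (.app (.pr (.prec f g)) (Matrix.vecCons y x)) x))))

/-- The Principle of Explicit Definition: `∃ g ∀ x₀ … xₖ₋₁, g(x₀, …, xₖ₋₁) = t`.  The function
variables of `t`, and its number variables other than `x₀, …, xₖ₋₁`, are free and hence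
read universally. -/
inductive explicitDefinition : Set Fml
  | intro (k : ℕ) (t : NTm) :
      explicitDefinition
        (.fex k (.alls k (.eq (.app (.var k 0) (fun i : Fin k => .var i))
          (t.subst NTm.var (shiftF k)))))

/-- Extensionality: functions that agree at all arguments are equal. -/
inductive extensionality : Set Fml
  | intro {k : ℕ} (f g : FTm k) :
      extensionality
        (.imp (.alls k (.eq (.app f (fun i : Fin k => .var i)) (.app g (fun i : Fin k => .var i))))
          (.feq f g))

/-! ### The theories -/

/-- The language of primitive recursive arithmetic: all identifiers of primitive recursive
functions, number variables and number quantifiers. -/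
def langPRA : Lang where
  fn := fun _ => True
  higher := False

/-- Primitive recursive arithmetic with induction for all formulas of its language. -/
def axPRA : Set Fml := separation ∪ definingEquations ∪ induction

/-- The language of `PRA*`: all terms and formulas. -/
def langPRAStar : Lang where
  fn := fun _ => True
  higher := True

/-- The axioms of `PRA*`. Induction now covers the whole extended language. -/
def axPRAStar : Set Fml := separation ∪ definingEquations ∪ induction ∪ explicitDefinition

/-- Addition, by recursion on the first argument: `add(0, x) = x`, `add(S y, x) = S add(y, x)`. -/
def PR.add : PR 2 := .prec (.proj 0) (.comp .succ ![.proj 1])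

/-- Multiplication: `mul(0, x) = 0`, `mul(S y, x) = add(x, mul(y, x))`. -/
def PR.mul : PR 2 := .prec (.comp .zero ![]) (.comp PR.add ![.proj 2, .proj 1])

/-- The sum `s + t`; the recursion is on `t`. -/
def NTm.add (s t : NTm) : NTm := .app (.pr PR.add) ![t, s]

/-- The product `s · t`; the recursion is on `t`. -/
def NTm.mul (s t : NTm) : NTm := .app (.pr PR.mul) ![t, s]

/-- The function identifiers of Peano arithmetic. -/
inductive SymbolPA : {k : ℕ} → PR k → Prop
  | zero : SymbolPA PR.zero
  | succ : SymbolPA PR.succ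
  | add : SymbolPA PR.add
  | mul : SymbolPA PR.mul

/-- The language of Peano arithmetic. -/
def langPA : Lang where
  fn := SymbolPA
  higher := False

/-- The recursion equations of addition and multiplication. -/
inductive addMulEquations : Set Fml
  | add_zero (s : NTm) : addMulEquations (.eq (s.add .zero) s)
  | add_succ (s t : NTm) : addMulEquations (.eq (s.add t.succ) (s.add t).succ)
  | mul_zero (s : NTm) : addMulEquations (.eq (s.mul .zero) .zero)
  | mul_succ (s t : NTm) : addMulEquations (.eq (s.mul t.succ) ((s.mul t).add s))

/-- Peano arithmetic. -/
def axPA : Set Fml := separation ∪ addMulEquations ∪ induction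

/-- `φ` is provable in primitive recursive arithmetic. -/
def ProvablePRA (φ : Fml) : Prop := Provable langPRA axPRA φ

/-- `φ` is provable in Peano arithmetic. -/
def ProvablePA (φ : Fml) : Prop := Provable langPA axPA φ

/-- `φ` is provable in `PRA*` from the additional axioms `E`. -/
def ProvablePRAStar (E : Set Fml) (φ : Fml) : Prop := Provable langPRAStar (axPRAStar ∪ E) φ

end Arith

namespace Arith

/-! ### Semantics -/

/-! The argument is model-theoretic. By `completeness`, a first-order formula is provable in PA or
PRA if it holds in every countable model. So it suffices to turn such a model, without changing its
domain or the values of its own identifiers, into a model of PRA* with extensionality. A theorem of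
PRA* holds there by `soundness`, and a first-order formula does not notice the added function sorts
(`sat_congr`).

On a model `M`, the function variables range over the functions that have a code in `M`, standard or
not. Codes are built from constants, the successor, projections, pairing, composition and primitive
recursion. The evaluation relation `Ev` is arithmetical: a computation is a finite set of evaluation
statements, and finite sets are coded by divisibility as in Gödel's beta function (`exists_code`,
`gen_iff`). Induction in `M` shows that recursion preserves totality (`tot_rec`), which yields all
primitive recursive functions. Composition gives every function defined by a term a code, which is
explicit definition (`exists_code_term`). A quantifier over functions is now a quantifier over
codes, so each formula of the extended language defines an arithmetical predicate with parameters
(`isDef_sat`), and its induction axiom is an instance of first-order induction in `M`. Equations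
between functions are read as true equality, which gives extensionality. Functional variables are
never quantified, so a single interpretation is enough: all of them return the zero function.

The identifiers keep their values because recursion equations have unique solutions under induction:
`PAStr.fn_symbol` treats zero, successor, sum and product, `PAStr.fn_eq` all identifiers of PRA. -/

/-- A structure on the carrier `M`: an interpretation of the identifiers, the range of the
function variables, and the common value of all functional variables. -/
structure Str (M : Type) where
  fn : ∀ {k : ℕ}, PR k → (Fin k → M) → M
  dom : ∀ k : ℕ, Set ((Fin k → M) → M)
  fnl : ∀ k : ℕ, (Fin k → M) → M

/-- Assignments of functions to the function variables. -/
abbrev FEnv (M : Type) := ∀ k : ℕ, ℕ → (Fin k → M) → M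

/-- The assignment `e` with `x` prepended. -/
def scons {α : Type} (x : α) (e : ℕ → α) : ℕ → α
  | 0 => x
  | n + 1 => e n

/-- The assignment `ε` with `f` prepended to its `k`-ary part. -/
def fcons {M : Type} {k : ℕ} (f : (Fin k → M) → M) (ε : FEnv M) : FEnv M := fun j n =>
  if h : j = k then
    match n with
    | 0 => h ▸ f
    | m + 1 => ε j m
  else ε j n

variable {M : Type}

/-- The value of a term for a function. -/
def FTm.eval (S : Str M) (ε : FEnv M) : {k : ℕ} → FTm k → (Fin k → M) → M
  | k, .var _ n => ε k n
  | _, .pr c => S.fn c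
  | _, .fnl _ b _ _ => S.fnl b

/-- The value of a term for a number. -/
def NTm.eval (S : Str M) (e : ℕ → M) (ε : FEnv M) : NTm → M
  | .var n => e n
  | .app f args => f.eval S ε (fun i => (args i).eval S e ε)

/-- Satisfaction. -/
def Sat (S : Str M) : (ℕ → M) → FEnv M → Fml → Prop
  | e, ε, .eq s t => s.eval S e ε = t.eval S e ε
  | _, ε, .feq f g => f.eval S ε = g.eval S ε
  | _, _, .bot => False
  | e, ε, .imp φ ψ => Sat S e ε φ → Sat S e ε ψ
  | e, ε, .all φ => ∀ x, Sat S (scons x e) ε φ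
  | e, ε, .fall k φ => ∀ f ∈ S.dom k, Sat S e (fcons f ε) φ

/-- No recursion is needed: an applied functional variable has a value that ignores its arguments.
-/
theorem FTm.eval_subst (S : Str M) (ε : FEnv M) (τ : ∀ k, ℕ → FTm k) {k : ℕ} (f : FTm k) :
    (f.subst τ).eval S ε = f.eval S (fun j n => (τ j n).eval S ε) := by
  cases f <;> rfl

theorem NTm.eval_subst (S : Str M) (e : ℕ → M) (ε : FEnv M) (σ : ℕ → NTm)
    (τ : ∀ k, ℕ → FTm k) (t : NTm) :
    (t.subst σ τ).eval S e ε =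
      t.eval S (fun n => (σ n).eval S e ε) (fun j n => (τ j n).eval S ε) := by
  induction t with
  | var n => rfl
  | app f args ih =>
    simp only [NTm.subst, NTm.eval, FTm.eval_subst, ih]

theorem FTm.eval_shiftF (S : Str M) (ε : FEnv M) {k : ℕ} (f : (Fin k → M) → M) :
    (fun j n => (shiftF k j n).eval S (fcons f ε)) = ε := by
  funext j n
  by_cases h : j = k
  · subst h; simp [shiftF, FTm.eval, fcons]
  · simp [shiftF, FTm.eval, fcons, h]

theorem NTm.eval_shiftN (S : Str M) (e : ℕ → M) (ε : FEnv M) (x : M) (t : NTm) :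
    (t.subst shiftN FTm.var).eval S (scons x e) ε = t.eval S e ε := by
  rw [NTm.eval_subst]; rfl

theorem NTm.eval_liftF (S : Str M) (e : ℕ → M) (ε : FEnv M) {k : ℕ} (f : (Fin k → M) → M)
    (t : NTm) :
    (t.subst NTm.var (shiftF k)).eval S e (fcons f ε) = t.eval S e ε := by
  rw [NTm.eval_subst, FTm.eval_shiftF]; rfl

theorem eval_upN (S : Str M) (e : ℕ → M) (ε : FEnv M) (x : M) (σ : ℕ → NTm) :
    (fun n => (upN σ n).eval S (scons x e) ε) = scons x (fun n => (σ n).eval S e ε) := by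
  funext n
  cases n with
  | zero => rfl
  | succ n => exact NTm.eval_shiftN ..

theorem eval_upF (S : Str M) (ε : FEnv M) {k : ℕ} (f : (Fin k → M) → M)
    (τ : ∀ j, ℕ → FTm j) :
    (fun j n => (upF k τ j n).eval S (fcons f ε)) =
      fcons f (fun j n => (τ j n).eval S ε) := by
  funext j n
  by_cases h : j = k
  · subst h
    cases n with
    | zero => simp [upF, fcons, FTm.eval]
    | succ n => simp [upF, fcons, FTm.eval_subst, FTm.eval_shiftF]
  · simp [upF, fcons, h, FTm.eval_subst, FTm.eval_shiftF]

theorem sat_subst (S : Str M) (φ : Fml) : ∀ (e : ℕ → M) (ε : FEnv M) (σ : ℕ → NTm)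
    (τ : ∀ k, ℕ → FTm k), Sat S e ε (φ.subst σ τ) ↔
      Sat S (fun n => (σ n).eval S e ε) (fun j n => (τ j n).eval S ε) φ := by
  induction φ with
  | eq s t => intros; simp only [Fml.subst, Sat, NTm.eval_subst]
  | feq f g => intros; simp only [Fml.subst, Sat, FTm.eval_subst]
  | bot => intros; rfl
  | imp φ ψ ih₁ ih₂ => intros; simp only [Fml.subst, Sat, ih₁, ih₂]
  | all φ ih => intros; simp only [Fml.subst, Sat, ih, eval_upN]
  | fall k φ ih => intros; simp only [Fml.subst, Sat, ih, eval_upF, NTm.eval_liftF]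

theorem sat_instN (S : Str M) (e : ℕ → M) (ε : FEnv M) (φ : Fml) (t : NTm) :
    Sat S e ε (φ.instN t) ↔ Sat S (scons (t.eval S e ε) e) ε φ := by
  rw [Fml.instN, sat_subst]
  refine iff_of_eq (congrArg₂ (fun a b => Sat S a b φ) ?_ rfl)
  funext n; cases n <;> rfl

theorem sat_liftN (S : Str M) (e : ℕ → M) (ε : FEnv M) (φ : Fml) (x : M) :
    Sat S (scons x e) ε φ.liftN ↔ Sat S e ε φ := by
  rw [Fml.liftN, sat_subst]; rfl

theorem sat_liftF (S : Str M) (e : ℕ → M) (ε : FEnv M) {k : ℕ} (φ : Fml)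
    (f : (Fin k → M) → M) : Sat S e (fcons f ε) (φ.liftF k) ↔ Sat S e ε φ := by
  rw [Fml.liftF, sat_subst, FTm.eval_shiftF]; rfl

theorem sat_instF (S : Str M) (e : ℕ → M) (ε : FEnv M) {k : ℕ} (φ : Fml) (f : FTm k) :
    Sat S e ε (φ.instF f) ↔ Sat S e (fcons (f.eval S ε) ε) φ := by
  rw [Fml.instF, sat_subst]
  refine iff_of_eq (congrArg₂ (fun a b => Sat S a b φ) rfl ?_)
  funext j n
  by_cases h : j = k
  · subst h; cases n <;> simp [fcons, FTm.eval]
  · simp [fcons, h, FTm.eval]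

theorem sat_stepN (S : Str M) (e : ℕ → M) (ε : FEnv M) (φ : Fml) (x : M) :
    Sat S (scons x e) ε φ.stepN ↔ Sat S (scons (S.fn .succ ![x]) e) ε φ := by
  rw [Fml.stepN, sat_subst]
  refine iff_of_eq (congrArg₂ (fun a b => Sat S a b φ) ?_ rfl)
  funext n
  cases n with
  | zero =>
    simp only [NTm.eval, scons, NTm.succ, FTm.eval]
    congr 1; funext i; fin_cases i; rfl
  | succ n => rfl

/-- `(v 0, …, v (k - 1), e 0, e 1, …)`. -/
def vapp {k : ℕ} (v : Fin k → M) (e : ℕ → M) : ℕ → M := fun n =>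
  if h : n < k then v ⟨n, h⟩ else e (n - k)

theorem vapp_snoc {k : ℕ} (v : Fin k → M) (x : M) (e : ℕ → M) :
    vapp (Fin.snoc v x : Fin (k + 1) → M) e = vapp v (scons x e) := by
  funext n
  unfold vapp
  rcases lt_trichotomy n k with h | h | h
  · simp [h, Nat.lt_succ_of_lt h, Fin.snoc]
  · subst h; simp [Fin.snoc, scons]
  · obtain ⟨m, rfl⟩ := Nat.exists_eq_add_of_lt h
    have h1 : ¬ k + m + 1 < k + 1 := by omega
    have h2 : ¬ k + m + 1 < k := by omega
    have h3 : k + m + 1 - (k + 1) = m := by omega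
    have h4 : k + m + 1 - k = m + 1 := by omega
    simp [h1, h2, h3, h4, scons]

theorem vapp_coe {k : ℕ} (v : Fin k → M) (e : ℕ → M) (i : Fin k) : vapp v e i = v i := by
  simp [vapp]

theorem sat_alls (S : Str M) (ε : FEnv M) (φ : Fml) (k : ℕ) : ∀ e : ℕ → M,
    Sat S e ε (Fml.alls k φ) ↔ ∀ v : Fin k → M, Sat S (vapp v e) ε φ := by
  induction k with
  | zero =>
    intro e
    have : ∀ v : Fin 0 → M, vapp v e = e := fun v => by funext n; simp [vapp]
    simp [Fml.alls, this]
  | succ k ih =>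
    intro e
    simp only [Fml.alls, Sat, ih, ← vapp_snoc]
    constructor
    -- The outermost quantifier of `Fml.alls` binds the variable of highest index, so its value is
    -- the last entry of the tuple.
    · intro h v
      simpa using h (v (Fin.last k)) (Fin.init v)
    · exact fun h x v => h _

/-! ### Soundness -/

/-- The assignment takes its values in the range of the function variables. -/
def FEnv.Ok (S : Str M) (ε : FEnv M) : Prop := ∀ k n, ε k n ∈ S.dom k

theorem FEnv.Ok.fcons {S : Str M} {ε : FEnv M} (h : ε.Ok S) {k : ℕ} {f : (Fin k → M) → M}
    (hf : f ∈ S.dom k) : (fcons f ε).Ok S := by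
  intro j n
  by_cases hj : j = k
  · subst hj; cases n <;> simp [Arith.fcons, hf, h _ _]
  · simp [Arith.fcons, hj, h _ _]

theorem FTm.eval_mem {S : Str M} (hfn : ∀ {k : ℕ} (c : PR k), S.fn c ∈ S.dom k)
    (hfnl : ∀ k, S.fnl k ∈ S.dom k) {ε : FEnv M} (h : ε.Ok S) {k : ℕ} (f : FTm k) :
    f.eval S ε ∈ S.dom k := by
  cases f with
  | var k n => exact h _ _
  | pr c => exact hfn c
  | fnl a b n args => exact hfnl _

/-- Function quantifiers range over `S.dom` only, so instantiation is sound only if every function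
term has its value there. This is the role of the two closure hypotheses and of `FEnv.Ok`. -/
theorem soundness {S : Str M} (hfn : ∀ {k : ℕ} (c : PR k), S.fn c ∈ S.dom k)
    (hfnl : ∀ k, S.fnl k ∈ S.dom k) {L : Lang} {Ax : Set Fml}
    (hAx : ∀ φ ∈ Ax, ∀ e ε, FEnv.Ok S ε → Sat S e ε φ) {φ : Fml} (h : Provable L Ax φ) :
    ∀ e ε, FEnv.Ok S ε → Sat S e ε φ := by
  induction h with
  | ax h _ => exact hAx _ h
  | mp _ _ ih₁ ih₂ => exact fun e ε hε => ih₁ e ε hε (ih₂ e ε hε)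
  | imp_const _ => exact fun e ε _ h _ => h
  | imp_dist _ => exact fun e ε _ h₁ h₂ h₃ => h₁ h₃ (h₂ h₃)
  | dne _ => exact fun e ε _ h => not_not.1 h
  | gen _ ih => exact fun e ε hε x => ih _ ε hε
  | all_dist _ => exact fun e ε _ h₁ h₂ x => h₁ x (h₂ x)
  | all_vac _ => exact fun e ε _ h x => (sat_liftN ..).2 h
  | all_inst _ => exact fun e ε _ h => (sat_instN ..).2 (h _)
  | fgen _ _ ih => exact fun e ε hε f hf => ih e _ (hε.fcons hf)
  | fall_dist _ => exact fun e ε _ h₁ h₂ f hf => h₁ f hf (h₂ f hf)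
  | fall_vac _ => exact fun e ε _ h f _ => (sat_liftF ..).2 h
  | fall_inst _ => exact fun e ε hε h => (sat_instF ..).2 (h _ (FTm.eval_mem hfn hfnl hε _))
  | eq_refl _ => exact fun e ε _ => rfl
  | eq_subst _ =>
    intro e ε _ h₁ h₂
    rw [sat_instN] at h₂ ⊢
    exact (show NTm.eval S e ε _ = _ from h₁) ▸ h₂
  | feq_refl _ => exact fun e ε _ => rfl
  | feq_subst _ =>
    intro e ε _ h₁ h₂
    rw [sat_instF] at h₂ ⊢
    exact (show FTm.eval S ε _ = _ from h₁) ▸ h₂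

/-! ### First-order formulas -/

/-- The value of a first-order term does not depend on the functions assigned to variables. -/
theorem NTm.eval_congr {L : Lang} (hL : ¬ L.higher) {S T : Str M}
    (h : ∀ {k : ℕ} (c : PR k), L.fn c → S.fn c = T.fn c) (e : ℕ → M) (ε δ : FEnv M) (t : NTm)
    (ht : t.InLang L) : t.eval S e ε = t.eval T e δ := by
  induction t with
  | var n => rfl
  | app f args ih =>
    cases f with
    | var k n => exact absurd ht.1 hL
    | pr c =>
      simp only [NTm.eval, FTm.eval, h c ht.1]
      exact congrArg _ (funext fun i => ih i (ht.2 i))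
    | fnl a b n args => exact absurd ht.1.1 hL

theorem sat_congr {L : Lang} (hL : ¬ L.higher) {S T : Str M}
    (h : ∀ {k : ℕ} (c : PR k), L.fn c → S.fn c = T.fn c) (ε δ : FEnv M) (φ : Fml) :
    φ.InLang L → ∀ e, Sat S e ε φ ↔ Sat T e δ φ := by
  induction φ with
  | eq s t =>
    intro hφ e
    simp only [Sat, NTm.eval_congr hL h e ε δ s hφ.1, NTm.eval_congr hL h e ε δ t hφ.2]
  | feq f g => exact fun hφ => absurd hφ.1 hL
  | bot => exact fun _ _ => Iff.rfl
  | imp φ ψ ih₁ ih₂ => exact fun hφ e => imp_congr (ih₁ hφ.1 e) (ih₂ hφ.2 e)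
  | all φ ih => exact fun hφ e => forall_congr' fun x => ih hφ _
  | fall k φ ih => exact fun hφ => absurd hφ.1 hL

end Arith

namespace Arith

/-! ### Countability of the syntax -/

/-- A numerical code of an identifier. -/
def PR.toNat : {n : ℕ} → PR n → ℕ
  | _, .zero => Nat.pair 0 0
  | _, .succ => Nat.pair 1 0
  | _, .proj i => Nat.pair 2 i
  | _, @PR.comp m _ f g =>
      Nat.pair 3 (Nat.pair m (Nat.pair f.toNat (Encodable.encode (List.ofFn fun i => (g i).toNat))))
  | _, .prec f g => Nat.pair 4 (Nat.pair f.toNat g.toNat)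

/-- The arity is not part of the code, so codes separate only identifiers of the same arity; the
intermediate arity of a composition has to be recorded. -/
theorem PR.toNat_injective {n : ℕ} (c : PR n) : ∀ d : PR n, c.toNat = d.toNat → c = d := by
  induction c with
  | zero => intro d h; cases d <;> simp_all [PR.toNat]
  | succ => intro d h; cases d <;> simp_all [PR.toNat]
  | proj i =>
    intro d h
    cases d <;> simp_all [PR.toNat, Fin.ext_iff]
  | comp f g ihf ihg =>
    intro d h
    cases d with
    | comp f' g' =>
      simp only [PR.toNat, Nat.pair_eq_pair, true_and] at h
      obtain ⟨rfl, hf, hg⟩ := h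
      rw [ihf _ hf]
      have hg := List.ofFn_injective (Encodable.encode_injective hg)
      rw [funext fun i => ihg i _ (congrFun hg i)]
    | _ => simp [PR.toNat] at h
  | prec f g ihf ihg =>
    intro d h
    cases d with
    | prec f' g' =>
      simp only [PR.toNat, Nat.pair_eq_pair, true_and] at h
      rw [ihf _ h.1, ihg _ h.2]
    | _ => simp [PR.toNat] at h

/-- A numerical code of a term for a function. -/
def FTm.toNat : {k : ℕ} → FTm k → ℕ
  | _, .var _ n => Nat.pair 0 n
  | _, .pr c => Nat.pair 1 c.toNat
  | _, @FTm.fnl r a _ n args =>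
      Nat.pair 2 (Nat.pair r (Nat.pair (Encodable.encode (List.ofFn a)) (Nat.pair n
        (Encodable.encode (List.ofFn fun i => (args i).toNat)))))

theorem FTm.toNat_injective {k : ℕ} (f : FTm k) : ∀ g : FTm k, f.toNat = g.toNat → f = g := by
  induction f with
  | var k n => intro d h; cases d <;> simp_all [FTm.toNat]
  | pr c =>
    intro d h
    cases d with
    | pr d =>
      simp only [FTm.toNat, Nat.pair_eq_pair, true_and] at h
      rw [PR.toNat_injective _ _ h]
    | _ => simp [FTm.toNat] at h
  | fnl a b n args ih =>
    intro d h
    cases d with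
    | fnl a' b n' args' =>
      simp only [FTm.toNat, Nat.pair_eq_pair, true_and] at h
      obtain ⟨rfl, ha, rfl, hg⟩ := h
      obtain rfl := List.ofFn_injective (Encodable.encode_injective ha)
      have hg := List.ofFn_injective (Encodable.encode_injective hg)
      rw [funext fun i => ih i _ (congrFun hg i)]
    | _ => simp [FTm.toNat] at h

/-- A numerical code of a term for a number. -/
def NTm.toNat : NTm → ℕ
  | .var n => Nat.pair 0 n
  | @NTm.app k f args =>
      Nat.pair 1 (Nat.pair k (Nat.pair f.toNat
        (Encodable.encode (List.ofFn fun i => (args i).toNat))))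

theorem NTm.toNat_injective (s : NTm) : ∀ t : NTm, s.toNat = t.toNat → s = t := by
  induction s with
  | var n => intro t h; cases t <;> simp_all [NTm.toNat]
  | app f args ih =>
    intro t h
    cases t with
    | var n => simp [NTm.toNat] at h
    | app f' args' =>
      simp only [NTm.toNat, Nat.pair_eq_pair, true_and] at h
      obtain ⟨rfl, hf, hg⟩ := h
      rw [FTm.toNat_injective _ _ hf]
      have hg := List.ofFn_injective (Encodable.encode_injective hg)
      rw [funext fun i => ih i _ (congrFun hg i)]

/-- A numerical code of a formula. -/
def Fml.toNat : Fml → ℕ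
  | .eq s t => Nat.pair 0 (Nat.pair s.toNat t.toNat)
  | @Fml.feq k f g => Nat.pair 1 (Nat.pair k (Nat.pair f.toNat g.toNat))
  | .bot => Nat.pair 2 0
  | .imp φ ψ => Nat.pair 3 (Nat.pair φ.toNat ψ.toNat)
  | .all φ => Nat.pair 4 φ.toNat
  | .fall k φ => Nat.pair 5 (Nat.pair k φ.toNat)

theorem Fml.toNat_injective (φ : Fml) : ∀ ψ : Fml, φ.toNat = ψ.toNat → φ = ψ := by
  induction φ with
  | eq s t =>
    intro ψ h
    cases ψ <;> simp only [Fml.toNat, Nat.pair_eq_pair, true_and] at h <;> try omega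
    rw [NTm.toNat_injective _ _ h.1, NTm.toNat_injective _ _ h.2]
  | feq f g =>
    intro ψ h
    cases ψ <;> simp only [Fml.toNat, Nat.pair_eq_pair, true_and] at h <;> try omega
    obtain ⟨rfl, hf, hg⟩ := h
    rw [FTm.toNat_injective _ _ hf, FTm.toNat_injective _ _ hg]
  | bot =>
    intro ψ h
    cases ψ <;> simp only [Fml.toNat, Nat.pair_eq_pair] at h <;> first | rfl | omega
  | imp φ₁ φ₂ ih₁ ih₂ =>
    intro ψ h
    cases ψ <;> simp only [Fml.toNat, Nat.pair_eq_pair, true_and] at h <;> try omega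
    rw [ih₁ _ h.1, ih₂ _ h.2]
  | all φ ih =>
    intro ψ h
    cases ψ <;> simp only [Fml.toNat, Nat.pair_eq_pair, true_and] at h <;> try omega
    rw [ih _ h]
  | fall k φ ih =>
    intro ψ h
    cases ψ <;> simp only [Fml.toNat, Nat.pair_eq_pair, true_and] at h <;> try omega
    rw [h.1, ih _ h.2]

instance : Countable NTm := Function.Injective.countable (f := NTm.toNat) NTm.toNat_injective

instance : Countable Fml := Function.Injective.countable (f := Fml.toNat) Fml.toNat_injective

/-! ### Substitution in first-order formulas -/

theorem FTm.subst_var {k : ℕ} (f : FTm k) : f.subst FTm.var = f := by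
  induction f with
  | var k n => rfl
  | pr c => rfl
  | fnl a b n args ih => simp only [FTm.subst, ih]

theorem NTm.subst_subst (σ ρ : ℕ → NTm) (t : NTm) :
    (t.subst σ FTm.var).subst ρ FTm.var =
      t.subst (fun n => (σ n).subst ρ FTm.var) FTm.var := by
  induction t with
  | var n => rfl
  | app f args ih => simp only [NTm.subst, FTm.subst_var, ih]

theorem NTm.subst_var (t : NTm) : t.subst NTm.var FTm.var = t := by
  induction t with
  | var n => rfl
  | app f args ih => simp only [NTm.subst, FTm.subst_var, ih]

theorem upN_comp (σ ρ : ℕ → NTm) :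
    (fun n => (upN σ n).subst (upN ρ) FTm.var) = upN (fun n => (σ n).subst ρ FTm.var) := by
  funext n
  cases n with
  | zero => rfl
  | succ n => simp only [upN, NTm.subst_subst]; rfl

theorem upN_var : upN NTm.var = NTm.var := by
  funext n; cases n <;> rfl

variable {L : Lang}

theorem NTm.var_inLang (n : ℕ) : (NTm.var n).InLang L := trivial

theorem NTm.InLang.subst {σ : ℕ → NTm} (hσ : ∀ n, (σ n).InLang L) {t : NTm} (ht : t.InLang L) :
    (t.subst σ FTm.var).InLang L := by
  induction t with
  | var n => exact hσ n
  | app f args ih => exact ⟨by rw [FTm.subst_var]; exact ht.1, fun i => ih i (ht.2 i)⟩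

theorem upN_inLang {σ : ℕ → NTm} (hσ : ∀ n, (σ n).InLang L) (n : ℕ) : (upN σ n).InLang L := by
  cases n with
  | zero => trivial
  | succ n => exact (hσ n).subst fun n => NTm.var_inLang (n + 1)

theorem iterate_upN_inLang (k : ℕ) : ∀ {σ : ℕ → NTm}, (∀ n, (σ n).InLang L) →
    ∀ n, (upN^[k] σ n).InLang L := by
  induction k with
  | zero => exact fun h => h
  | succ k ih => exact fun h => ih (upN_inLang h)

theorem scons_inLang {σ : ℕ → NTm} (hσ : ∀ n, (σ n).InLang L) {t : NTm} (ht : t.InLang L)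
    (n : ℕ) : (scons t σ n).InLang L := by
  cases n with
  | zero => exact ht
  | succ n => exact hσ n

theorem Fml.subst_inLang (hL : ¬ L.higher) {φ : Fml} : ∀ {σ : ℕ → NTm}, (∀ n, (σ n).InLang L) →
    φ.InLang L → (φ.subst σ FTm.var).InLang L := by
  induction φ with
  | eq s t => exact fun hσ h => ⟨NTm.InLang.subst hσ h.1, NTm.InLang.subst hσ h.2⟩
  | feq f g => exact fun _ h => absurd h.1 hL
  | bot => exact fun _ _ => trivial
  | imp φ ψ ih₁ ih₂ => exact fun hσ h => ⟨ih₁ hσ h.1, ih₂ hσ h.2⟩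
  | all φ ih => exact fun {σ} hσ h => ih (σ := upN σ) (upN_inLang hσ) h
  | fall k φ ih => exact fun _ h => absurd h.1 hL

theorem Fml.subst_subst (hL : ¬ L.higher) {φ : Fml} : ∀ (σ ρ : ℕ → NTm), φ.InLang L →
    (φ.subst σ FTm.var).subst ρ FTm.var =
      φ.subst (fun n => (σ n).subst ρ FTm.var) FTm.var := by
  induction φ with
  | eq s t => intros; simp only [Fml.subst, NTm.subst_subst]
  | feq f g => exact fun _ _ h => absurd h.1 hL
  | bot => intros; rfl
  | imp φ ψ ih₁ ih₂ => intro σ ρ h; simp only [Fml.subst, ih₁ σ ρ h.1, ih₂ σ ρ h.2]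
  | all φ ih => intro σ ρ h; simp only [Fml.subst, ih _ _ h, upN_comp]
  | fall k φ ih => exact fun _ _ h => absurd h.1 hL

theorem Fml.subst_var (hL : ¬ L.higher) {φ : Fml} : φ.InLang L →
    φ.subst NTm.var FTm.var = φ := by
  induction φ with
  | eq s t => intro; simp only [Fml.subst, NTm.subst_var]
  | feq f g => exact fun h => absurd h.1 hL
  | bot => intros; rfl
  | imp φ ψ ih₁ ih₂ => intro h; simp only [Fml.subst, ih₁ h.1, ih₂ h.2]
  | all φ ih => intro h; simp only [Fml.subst, upN_var, ih h]
  | fall k φ ih => exact fun h => absurd h.1 hL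

theorem instN_eq (φ : Fml) (t : NTm) : φ.instN t = φ.subst (scons t NTm.var) FTm.var := by
  unfold Fml.instN
  congr 1

theorem Fml.instN_subst_upN (hL : ¬ L.higher) {φ : Fml} (h : φ.InLang L) (σ : ℕ → NTm)
    (t : NTm) : (φ.subst (upN σ) FTm.var).instN t = φ.subst (scons t σ) FTm.var := by
  rw [instN_eq, Fml.subst_subst hL _ _ h]
  congr 1
  funext n
  cases n with
  | zero => rfl
  | succ n => exact (NTm.subst_subst ..).trans (NTm.subst_var _)

theorem NTm.exists_bound (t : NTm) : ∃ N, ∀ σ ρ : ℕ → NTm, (∀ i < N, σ i = ρ i) →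
    t.subst σ FTm.var = t.subst ρ FTm.var := by
  induction t with
  | var n => exact ⟨n + 1, fun σ ρ h => h n (Nat.lt_succ_self n)⟩
  | app f args ih =>
    choose N hN using ih
    refine ⟨Finset.univ.sup N, fun σ ρ h => ?_⟩
    simp only [NTm.subst]
    congr 1
    funext i
    exact hN i _ _ fun j hj => h j (hj.trans_le (Finset.le_sup (Finset.mem_univ i)))

/-- Finiteness of the set of free variables, phrased through substitution so that no notion of free
variable is needed. -/
theorem Fml.exists_bound (hL : ¬ L.higher) {φ : Fml} : φ.InLang L →
    ∃ N, ∀ σ ρ : ℕ → NTm, (∀ i < N, σ i = ρ i) →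
      φ.subst σ FTm.var = φ.subst ρ FTm.var := by
  induction φ with
  | eq s t =>
    intro _
    obtain ⟨N, hN⟩ := s.exists_bound
    obtain ⟨K, hK⟩ := t.exists_bound
    refine ⟨max N K, fun σ ρ h => ?_⟩
    simp only [Fml.subst]
    rw [hN σ ρ fun i hi => h i (lt_max_of_lt_left hi),
      hK σ ρ fun i hi => h i (lt_max_of_lt_right hi)]
  | feq f g => exact fun h => absurd h.1 hL
  | bot => exact fun _ => ⟨0, fun _ _ _ => rfl⟩
  | imp φ ψ ih₁ ih₂ =>
    intro h
    obtain ⟨N, hN⟩ := ih₁ h.1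
    obtain ⟨K, hK⟩ := ih₂ h.2
    refine ⟨max N K, fun σ ρ h => ?_⟩
    simp only [Fml.subst]
    rw [hN σ ρ fun i hi => h i (lt_max_of_lt_left hi),
      hK σ ρ fun i hi => h i (lt_max_of_lt_right hi)]
  | all φ ih =>
    intro h
    obtain ⟨N, hN⟩ := ih h
    refine ⟨N, fun σ ρ h => ?_⟩
    simp only [Fml.subst]
    rw [hN]
    intro i hi
    cases i with
    | zero => rfl
    | succ i => simp only [upN, h i (Nat.lt_of_succ_lt hi)]
  | fall k φ ih => exact fun h => absurd h.1 hL

/-! ### Derived rules of first-order logic -/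

theorem Provable.inLang {Ax : Set Fml} {φ : Fml} (h : Provable L Ax φ) : φ.InLang L := by
  induction h with
  | mp _ _ ih _ => exact ih.2
  | gen _ ih => exact ih
  | fgen hL _ ih => exact ⟨hL, ih⟩
  | _ => assumption

theorem Provable.mono {Ax Bx : Set Fml} (hAB : Ax ⊆ Bx) {φ : Fml} (h : Provable L Ax φ) :
    Provable L Bx φ := by
  induction h with
  | ax h hl => exact .ax (hAB h) hl
  | mp _ _ ih₁ ih₂ => exact .mp ih₁ ih₂
  | imp_const h => exact .imp_const h
  | imp_dist h => exact .imp_dist h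
  | dne h => exact .dne h
  | gen _ ih => exact .gen ih
  | all_dist h => exact .all_dist h
  | all_vac h => exact .all_vac h
  | all_inst h => exact .all_inst h
  | fgen hL _ ih => exact .fgen hL ih
  | fall_dist h => exact .fall_dist h
  | fall_vac h => exact .fall_vac h
  | fall_inst h => exact .fall_inst h
  | eq_refl h => exact .eq_refl h
  | eq_subst h => exact .eq_subst h
  | feq_refl h => exact .feq_refl h
  | feq_subst h => exact .feq_subst h

variable {Ax : Set Fml}

theorem Provable.instN (hL : ¬ L.higher) {φ : Fml} (h : Provable L Ax (.all φ)) {t : NTm}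
    (ht : t.InLang L) : Provable L Ax (φ.instN t) := by
  have hφ : φ.InLang L := h.inLang
  refine .mp (.all_inst ⟨hφ, ?_⟩) h
  rw [instN_eq]
  exact Fml.subst_inLang hL (scons_inLang NTm.var_inLang ht) hφ

theorem Provable.alls {φ : Fml} (h : Provable L Ax φ) (k : ℕ) : Provable L Ax (φ.alls k) := by
  induction k with
  | zero => exact h
  | succ k ih => exact ih.gen

theorem Fml.alls_subst (φ : Fml) (k : ℕ) : ∀ σ : ℕ → NTm,
    (φ.alls k).subst σ FTm.var = (φ.subst (upN^[k] σ) FTm.var).alls k := by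
  induction k with
  | zero => exact fun _ => rfl
  | succ k ih => intro σ; simp only [Fml.alls, Fml.subst, ih, Function.iterate_succ_apply]

/-- Instantiating the outermost of `k + 1` quantifiers pushes the term under the other `k`:
variables below `k` stay, variable `k` becomes the term shifted `k` times, and higher ones drop by
one. The substitution `ρ` undoes the shift. -/
theorem iterate_upN_scons (k : ℕ) (t : NTm) {ρ : ℕ → NTm} : (∀ m, ρ (k + m) = .var m) →
    (∀ i < k, (upN^[k] (scons t NTm.var) i) = .var i) ∧
    ((upN^[k] (scons t NTm.var) k).subst ρ FTm.var = t) ∧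
    (∀ m, upN^[k] (scons t NTm.var) (k + 1 + m) = .var (k + m)) := by
  induction k generalizing ρ with
  | zero =>
    intro h
    refine ⟨fun i hi => absurd hi (Nat.not_lt_zero i), ?_, fun m => ?_⟩
    · have : ρ = NTm.var := funext fun m => by simpa using h m
      rw [this, NTm.subst_var]; rfl
    · rw [Nat.add_comm, Nat.zero_add m]; simp [scons]
  | succ k ih =>
    intro h
    obtain ⟨h1, h2, h3⟩ := ih (ρ := fun n => ρ (n + 1)) fun m => by rw [← h m]; congr 1; omega
    rw [Function.iterate_succ_apply']
    refine ⟨fun i hi => ?_, ?_, fun m => ?_⟩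
    · cases i with
      | zero => rfl
      | succ i => simp only [upN, h1 i (Nat.lt_of_succ_lt_succ hi)]; rfl
    · simp only [upN, NTm.subst_subst]
      exact h2
    · rw [show k + 1 + 1 + m = (k + 1 + m) + 1 by omega]
      simp only [upN, h3]
      simp only [NTm.subst, shiftN]; congr 1; omega

theorem Provable.subst_of_alls (hL : ¬ L.higher) (k : ℕ) : ∀ {φ : Fml} {σ : ℕ → NTm},
    (∀ n, (σ n).InLang L) → (∀ m, σ (k + m) = .var m) → φ.InLang L →
    Provable L Ax (φ.alls k) → Provable L Ax (φ.subst σ FTm.var) := by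
  induction k with
  | zero =>
    intro φ σ _ h hφ hp
    have : σ = NTm.var := funext fun m => by simpa using h m
    rw [this, Fml.subst_var hL hφ]; exact hp
  | succ k ih =>
    intro φ σ hσ h hφ hp
    have h1 := Provable.instN hL hp (hσ k)
    rw [instN_eq, Fml.alls_subst] at h1
    -- The term `σ k` is inserted now and arrives shifted by `k`; the remaining `k` instantiations
    -- must also lower all variables from `k` on.
    set ρ : ℕ → NTm := fun n => if n < k then σ n else .var (n - k) with hρ
    have hρl : ∀ n, (ρ n).InLang L := fun n => by
      rw [hρ]; dsimp only; split_ifs; exacts [hσ n, trivial]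
    have hρk : ∀ m, ρ (k + m) = .var m := fun m => by simp [hρ]
    obtain ⟨e1, e2, e3⟩ := iterate_upN_scons k (σ k) hρk
    have hup := iterate_upN_inLang k (scons_inLang NTm.var_inLang (hσ k))
    have h2 := ih hρl hρk (Fml.subst_inLang hL hup hφ) h1
    rw [Fml.subst_subst hL _ _ hφ] at h2
    convert h2 using 2
    funext n
    rcases lt_trichotomy n k with hn | rfl | hn
    · rw [e1 n hn]; simp [NTm.subst, hρ, hn]
    · rw [e2]
    · obtain ⟨m, rfl⟩ := Nat.exists_eq_add_of_lt hn
      rw [show k + m + 1 = k + 1 + m by omega, e3, h]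
      exact (hρk m).symm

end Arith

namespace Arith
variable {L : Lang} {Ax : Set Fml}

/-- The calculus instantiates one variable at a time. Simultaneous substitution comes from
generalizing over the first `N` variables, beyond which none occurs, and instantiating them all;
what `σ` does from `N` on may thus be altered freely. -/
theorem Provable.subst (hL : ¬ L.higher) {φ : Fml} (h : Provable L Ax φ) {σ : ℕ → NTm}
    (hσ : ∀ n, (σ n).InLang L) : Provable L Ax (φ.subst σ FTm.var) := by
  obtain ⟨N, hN⟩ := Fml.exists_bound hL h.inLang
  rw [hN σ (fun n => if n < N then σ n else .var (n - N)) fun i hi => by simp [hi]]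
  refine Provable.subst_of_alls hL N (fun n => ?_) (fun m => by simp) h.inLang (h.alls N)
  split_ifs
  exacts [hσ n, trivial]

/-! ### Derivations from hypotheses -/

/-- The implication with conclusion `φ` and the premises in the list. -/
def Fml.imps : List Fml → Fml → Fml
  | [], φ => φ
  | γ :: Γ, φ => Fml.imps Γ (.imp γ φ)

/-- Derivability from a list of hypotheses. -/
def Der (L : Lang) (Ax : Set Fml) (Γ : List Fml) (φ : Fml) : Prop :=
  Provable L Ax (Fml.imps Γ φ)

theorem Fml.imps_inLang {Γ : List Fml} : ∀ {φ : Fml},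
    (Fml.imps Γ φ).InLang L ↔ (∀ γ ∈ Γ, γ.InLang L) ∧ φ.InLang L := by
  induction Γ with
  | nil => simp [Fml.imps]
  | cons γ Γ ih => intro φ; simp only [Fml.imps, ih, Fml.InLang, List.forall_mem_cons]; tauto

theorem Der.inLang {Γ : List Fml} {φ : Fml} (h : Der L Ax Γ φ) : φ.InLang L :=
  (Fml.imps_inLang.1 (Provable.inLang h)).2

theorem Der.hyps_inLang {Γ : List Fml} {φ : Fml} (h : Der L Ax Γ φ) : ∀ γ ∈ Γ, γ.InLang L :=
  (Fml.imps_inLang.1 (Provable.inLang h)).1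

theorem Der.of_provable {Γ : List Fml} : ∀ {φ : Fml}, (∀ γ ∈ Γ, γ.InLang L) →
    Provable L Ax φ → Der L Ax Γ φ := by
  induction Γ with
  | nil => exact fun _ h => h
  | cons γ Γ ih =>
    intro φ hΓ h
    rw [List.forall_mem_cons] at hΓ
    exact ih (φ := .imp γ φ) hΓ.2 (.mp (.imp_const ⟨h.inLang, hΓ.1, h.inLang⟩) h)

theorem Der.mp {Γ : List Fml} : ∀ {φ ψ : Fml}, Der L Ax Γ (.imp φ ψ) → Der L Ax Γ φ →
    Der L Ax Γ ψ := by
  induction Γ with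
  | nil => exact fun h₁ h₂ => Provable.mp h₁ h₂
  | cons γ Γ ih =>
    intro φ ψ h₁ h₂
    have hl := h₁.hyps_inLang
    rw [List.forall_mem_cons] at hl
    have hφ := h₁.inLang
    exact ih (ih (Der.of_provable hl.2
      (.imp_dist ⟨⟨hl.1, hφ⟩, ⟨hl.1, hφ.1⟩, hl.1, hφ.2⟩)) h₁) h₂

/-- By the definition of `Fml.imps`, a derivation from `γ :: Γ` is literally a derivation of an
implication from `Γ`. The deduction theorem is therefore definitional and is used tacitly below. -/
theorem Der.weaken {Γ : List Fml} {γ φ : Fml} (hγ : γ.InLang L) (h : Der L Ax Γ φ) :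
    Der L Ax (γ :: Γ) φ :=
  Der.mp (Γ := Γ) (.of_provable h.hyps_inLang (.imp_const ⟨h.inLang, hγ, h.inLang⟩)) h

theorem Provable.imp_self {φ : Fml} (h : φ.InLang L) : Provable L Ax (.imp φ φ) :=
  .mp (.mp (.imp_dist (ψ := .imp φ φ) ⟨⟨h, ⟨h, h⟩, h⟩, ⟨h, h, h⟩, h, h⟩)
    (.imp_const ⟨h, ⟨h, h⟩, h⟩)) (.imp_const ⟨h, h, h⟩)

theorem Der.head {Γ : List Fml} {γ : Fml} (hΓ : ∀ δ ∈ Γ, δ.InLang L) (hγ : γ.InLang L) :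
    Der L Ax (γ :: Γ) γ :=
  Der.of_provable (Γ := Γ) (φ := .imp γ γ) hΓ (.imp_self hγ)

theorem Fml.neg_inLang {φ : Fml} (h : φ.InLang L) : φ.neg.InLang L := ⟨h, trivial⟩

theorem Der.dne {Γ : List Fml} {φ : Fml} (h : Der L Ax Γ φ.neg.neg) : Der L Ax Γ φ :=
  .mp (.of_provable h.hyps_inLang (.dne ⟨h.inLang, h.inLang.1.1⟩)) h

theorem Der.exfalso {Γ : List Fml} {φ : Fml} (hφ : φ.InLang L) (h : Der L Ax Γ .bot) :
    Der L Ax Γ φ :=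
  Der.dne (Der.weaken (φ.neg_inLang hφ) h)

theorem Der.generalize {Γ : List Fml} : ∀ {φ : Fml}, (∀ γ ∈ Γ, γ.InLang L) →
    Der L Ax (Γ.map Fml.liftN) φ → Der L Ax Γ (.all φ) := by
  induction Γ with
  | nil => exact fun _ h => Provable.gen h
  | cons γ Γ ih =>
    intro φ hΓ h
    rw [List.forall_mem_cons] at hΓ
    have h1 : Der L Ax Γ (.all (.imp γ.liftN φ)) := ih hΓ.2 h
    have hl : (Fml.imp γ.liftN φ).InLang L := h1.inLang
    have h2 : Der L Ax Γ (.imp (.all γ.liftN) (.all φ)) :=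
      .mp (.of_provable hΓ.2 (.all_dist ⟨hl, hl⟩)) h1
    exact (h2.weaken hΓ.1).mp
      (Der.of_provable (Γ := Γ) (φ := .imp γ (.all γ.liftN)) hΓ.2 (.all_vac ⟨hΓ.1, hl.1⟩))

theorem Fml.imps_subst (Γ : List Fml) (σ : ℕ → NTm) (τ : ∀ k, ℕ → FTm k) : ∀ φ : Fml,
    (Fml.imps Γ φ).subst σ τ = Fml.imps (Γ.map fun γ => γ.subst σ τ) (φ.subst σ τ) := by
  induction Γ with
  | nil => exact fun _ => rfl
  | cons γ Γ ih => exact fun φ => ih _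

/-- A universal formula is derivable if its instances at all variables are, as one of them does
not occur in the hypotheses. -/
theorem Der.generalize_var (hL : ¬ L.higher) {Γ : List Fml} {φ : Fml}
    (hΓ : ∀ γ ∈ Γ, γ.InLang L) (hφ : φ.InLang L)
    (h : ∀ n, Der L Ax Γ (φ.instN (.var n))) : Der L Ax Γ (.all φ) := by
  have hb : ∃ N, ∀ γ ∈ φ :: Γ, ∀ σ ρ : ℕ → NTm, (∀ i < N, σ i = ρ i) →
      γ.subst σ FTm.var = γ.subst ρ FTm.var := by
    have hl : ∀ γ ∈ φ :: Γ, γ.InLang L := List.forall_mem_cons.2 ⟨hφ, hΓ⟩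
    clear h hΓ
    generalize φ :: Γ = Δ at hl ⊢
    induction Δ with
    | nil => exact ⟨0, by simp⟩
    | cons γ Γ ih =>
      rw [List.forall_mem_cons] at hl
      obtain ⟨N, hN⟩ := ih hl.2
      obtain ⟨K, hK⟩ := Fml.exists_bound hL hl.1
      refine ⟨max N K, List.forall_mem_cons.2 ⟨fun σ ρ h => hK σ ρ fun i hi =>
        h i (lt_max_of_lt_right hi), fun δ hδ σ ρ h => hN δ hδ σ ρ fun i hi =>
        h i (lt_max_of_lt_left hi)⟩⟩
  obtain ⟨N, hN⟩ := hb
  rw [List.forall_mem_cons] at hN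
  -- Variable `N` is fresh for `φ` and the hypotheses. Renaming it to `0` and shifting the others
  -- lifts the hypotheses and turns the instance at `N` back into `φ`.
  set σ : ℕ → NTm := fun m => if m = N then .var 0 else .var (m + 1) with hσ
  have h1 := Provable.subst hL (h N) (σ := σ) fun n => by
    rw [hσ]; dsimp only; split_ifs <;> trivial
  rw [Fml.imps_subst] at h1
  refine Der.generalize hΓ ?_
  have e1 : Γ.map Fml.liftN = Γ.map fun γ => γ.subst σ FTm.var :=
    List.map_congr_left fun γ hγ => hN.2 γ hγ _ _ fun i hi => by simp [hσ, hi.ne, shiftN]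
  have e2 : (φ.instN (.var N)).subst σ FTm.var = φ := by
    rw [instN_eq, Fml.subst_subst hL _ _ hφ]
    refine (hN.1 _ NTm.var fun i hi => ?_).trans (Fml.subst_var hL hφ)
    cases i with
    | zero => simp [scons, NTm.subst, hσ]
    | succ i => simp [scons, NTm.subst, hσ, (Nat.lt_of_succ_lt hi).ne]
  rw [e2] at h1
  rw [Der, e1]
  exact h1

/-! ### Completeness -/

/-- Consistent lists of hypotheses, ordered by derivability. -/
structure Cond (L : Lang) (Ax : Set Fml) where
  hyps : List Fml
  inLang : ∀ γ ∈ hyps, γ.InLang L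
  consistent : ¬ Der L Ax hyps .bot

instance : Preorder (Cond L Ax) where
  le Γ Δ := ∀ φ, Der L Ax Γ.hyps φ → Der L Ax Δ.hyps φ
  le_refl _ _ h := h
  le_trans _ _ _ h₁ h₂ φ h := h₂ φ (h₁ φ h)

/-- `Γ` decides `φ`, with a witness if `φ` is a refuted universal formula. -/
def Cond.Decides (Γ : Cond L Ax) (φ : Fml) : Prop :=
  Der L Ax Γ.hyps φ ∨ Der L Ax Γ.hyps φ.neg ∧
    ∀ ψ, φ = .all ψ → ∃ n, Der L Ax Γ.hyps (ψ.instN (.var n)).neg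

/-- The condition extended by a further hypothesis. -/
def Cond.cons (Γ : Cond L Ax) (φ : Fml) (hφ : φ.InLang L) (h : ¬ Der L Ax Γ.hyps φ.neg) :
    Cond L Ax where
  hyps := φ :: Γ.hyps
  inLang := List.forall_mem_cons.2 ⟨hφ, Γ.inLang⟩
  consistent := h

theorem Cond.le_cons (Γ : Cond L Ax) (φ : Fml) (hφ : φ.InLang L)
    (h : ¬ Der L Ax Γ.hyps φ.neg) : Γ ≤ Γ.cons φ hφ h :=
  fun _ hd => hd.weaken hφ

/-- If a universal formula is refuted, its variable instances cannot all be derivable, by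
`Der.generalize_var`; negating an underivable one is consistent and supplies the witness. Variables
serve as Henkin constants because a finite list leaves some of them fresh. -/
theorem Cond.exists_decides (hL : ¬ L.higher) (Γ : Cond L Ax) {φ : Fml} (hφ : φ.InLang L) :
    ∃ Δ, Γ ≤ Δ ∧ Δ.Decides φ := by
  by_cases h : Der L Ax Γ.hyps φ.neg
  · by_cases hψ : ∃ ψ, φ = .all ψ
    · obtain ⟨ψ, rfl⟩ := hψ
      have h1 : ∃ n, ¬ Der L Ax Γ.hyps (ψ.instN (.var n)) := by
        by_contra! h2
        exact Γ.consistent (h.mp (Der.generalize_var hL Γ.inLang hφ h2))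
      obtain ⟨n, hn⟩ := h1
      have hl : (ψ.instN (.var n)).InLang L := by
        rw [instN_eq]
        exact Fml.subst_inLang hL (scons_inLang NTm.var_inLang (NTm.var_inLang n)) hφ
      refine ⟨Γ.cons (ψ.instN (.var n)).neg (Fml.neg_inLang hl) fun h2 => hn h2.dne,
        Γ.le_cons _ _ _, Or.inr ⟨Γ.le_cons _ _ _ _ h, ?_⟩⟩
      rintro _ ⟨⟩
      exact ⟨n, Der.head Γ.inLang (Fml.neg_inLang hl)⟩
    · exact ⟨Γ, le_refl Γ, Or.inr ⟨h, fun ψ h => absurd ⟨ψ, h⟩ hψ⟩⟩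
  · exact ⟨Γ.cons φ hφ h, Γ.le_cons _ _ _, Or.inl (Der.head Γ.inLang hφ)⟩

/-- A complete Henkin theory of first-order formulas. -/
structure Henkin (L : Lang) (Ax : Set Fml) where
  mem : Fml → Prop
  inLang : ∀ {φ}, mem φ → φ.InLang L
  of_provable : ∀ {φ}, Provable L Ax φ → mem φ
  mp : ∀ {φ ψ}, mem (.imp φ ψ) → mem φ → mem ψ
  not_bot : ¬ mem .bot
  complete : ∀ {φ}, φ.InLang L → ¬ mem φ → mem φ.neg
  witness : ∀ {φ}, φ.InLang L → (∀ n, mem (φ.instN (.var n))) → mem (.all φ)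

/-- The Rasiowa–Sikorski argument: deciding a formula is a cofinal requirement on conditions, there
are countably many formulas, and the consequences of the conditions in an ideal that meets all
requirements form the theory. -/
theorem exists_henkin (hL : ¬ L.higher) {φ : Fml} (hφ : φ.InLang L)
    (h : ¬ Provable L Ax φ) : ∃ T : Henkin L Ax, T.mem φ.neg := by
  let Γ₀ : Cond L Ax := ⟨[φ.neg], by simpa using Fml.neg_inLang hφ,
    fun h' => h (Der.dne (Γ := []) h')⟩
  let ι := {ψ : Fml // ψ.InLang L}
  have : Encodable ι := Encodable.ofCountable ι
  let 𝒟 : ι → Order.Cofinal (Cond L Ax) := fun ψ =>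
    ⟨{Γ | Γ.Decides ψ.1}, fun Γ => by
      obtain ⟨Δ, h1, h2⟩ := Γ.exists_decides hL ψ.2
      exact ⟨Δ, h2, h1⟩⟩
  let I := Order.idealOfCofinals Γ₀ 𝒟
  have hI : ∀ ψ : Fml, ψ.InLang L → ∃ Γ ∈ I, Γ.Decides ψ := fun ψ hψ => by
    obtain ⟨Γ, h1, h2⟩ := Order.cofinal_meets_idealOfCofinals Γ₀ 𝒟 ⟨ψ, hψ⟩
    exact ⟨Γ, h2, h1⟩
  have hdir : ∀ {Γ Δ : Cond L Ax}, Γ ∈ I → Δ ∈ I → ∃ Θ ∈ I, Γ ≤ Θ ∧ Δ ≤ Θ :=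
    fun h₁ h₂ => I.directed _ h₁ _ h₂
  refine ⟨⟨fun ψ => ∃ Γ ∈ I, Der L Ax Γ.hyps ψ, ?_, ?_, ?_, ?_, ?_, ?_⟩, Γ₀,
    Order.mem_idealOfCofinals Γ₀ 𝒟, Der.head (by simp) (Fml.neg_inLang hφ)⟩
  · rintro ψ ⟨Γ, _, h⟩; exact h.inLang
  · exact fun h => ⟨Γ₀, Order.mem_idealOfCofinals Γ₀ 𝒟, .of_provable Γ₀.inLang h⟩
  · rintro ψ χ ⟨Γ, hΓ, h₁⟩ ⟨Δ, hΔ, h₂⟩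
    obtain ⟨Θ, hΘ, h₃, h₄⟩ := hdir hΓ hΔ
    exact ⟨Θ, hΘ, (h₃ _ h₁).mp (h₄ _ h₂)⟩
  · rintro ⟨Γ, _, h⟩; exact Γ.consistent h
  · intro ψ hψ hn
    obtain ⟨Γ, hΓ, h | h⟩ := hI ψ hψ
    · exact absurd ⟨Γ, hΓ, h⟩ hn
    · exact ⟨Γ, hΓ, h.1⟩
  · intro ψ hψ hn
    obtain ⟨Γ, hΓ, h | h⟩ := hI (.all ψ) hψ
    · exact ⟨Γ, hΓ, h⟩
    · obtain ⟨n, hn'⟩ := h.2 ψ rfl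
      obtain ⟨Δ, hΔ, hd⟩ := hn n
      obtain ⟨Θ, _, h₃, h₄⟩ := hdir hΓ hΔ
      exact absurd ((h₃ _ hn').mp (h₄ _ hd)) Θ.consistent

/-! ### The term model of a Henkin theory -/

namespace Henkin

variable (T : Henkin L Ax)

theorem mem_imp {φ ψ : Fml} (hφ : φ.InLang L) (hψ : ψ.InLang L) :
    T.mem (.imp φ ψ) ↔ (T.mem φ → T.mem ψ) := by
  refine ⟨T.mp, fun h => ?_⟩
  by_cases h1 : T.mem φ
  · exact T.mp (T.of_provable (.imp_const ⟨hψ, hφ, hψ⟩)) (h h1)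
  · have h2 := T.complete hφ h1
    refine T.mp (T.of_provable ?_) h2
    exact (Der.exfalso (Γ := [φ, φ.neg]) hψ (Der.mp (φ := φ)
      ((Der.head (Γ := []) (by simp) (Fml.neg_inLang hφ)).weaken hφ)
      (Der.head (by simpa using Fml.neg_inLang hφ) hφ)))

theorem mem_all (hL : ¬ L.higher) {φ : Fml} (hφ : φ.InLang L) :
    T.mem (.all φ) ↔ ∀ t : NTm, t.InLang L → T.mem (φ.instN t) := by
  refine ⟨fun h t ht => T.mp (T.of_provable (.all_inst ⟨hφ, ?_⟩)) h,
    fun h => T.witness hφ fun n => h _ (NTm.var_inLang n)⟩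
  rw [instN_eq]
  exact Fml.subst_inLang hL (scons_inLang NTm.var_inLang ht) hφ

theorem mem_of_eq (hL : ¬ L.higher) (φ : Fml) (hφ : φ.InLang L) {s t : NTm} (hs : s.InLang L)
    (ht : t.InLang L) (h : T.mem (.eq s t)) (h' : T.mem (φ.instN s)) : T.mem (φ.instN t) := by
  refine T.mp (T.mp (T.of_provable (.eq_subst ⟨⟨hs, ht⟩, T.inLang h', ?_⟩)) h) h'
  rw [instN_eq]
  exact Fml.subst_inLang hL (scons_inLang NTm.var_inLang ht) hφ

theorem instN_lift (t s : NTm) :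
    (t.subst shiftN FTm.var).subst (scons s NTm.var) FTm.var = t := by
  rw [NTm.subst_subst]; exact NTm.subst_var t

theorem eq_refl {t : NTm} (ht : t.InLang L) : T.mem (.eq t t) :=
  T.of_provable (.eq_refl ⟨ht, ht⟩)

theorem shift_inLang {t : NTm} (ht : t.InLang L) : (t.subst shiftN FTm.var).InLang L :=
  ht.subst fun n => NTm.var_inLang (n + 1)

/-- Leibniz's law for the formula "`x` equals `s`", with `s` shifted to keep it clear of `x`. -/
theorem eq_symm (hL : ¬ L.higher) {s t : NTm} (h : T.mem (.eq s t)) : T.mem (.eq t s) := by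
  have hl := T.inLang h
  have := T.mem_of_eq hL (.eq (.var 0) (s.subst shiftN FTm.var))
    ⟨trivial, shift_inLang hl.1⟩ hl.1 hl.2 h
  simp only [instN_eq, Fml.subst, instN_lift] at this
  exact this (T.eq_refl hl.1)

theorem eq_trans (hL : ¬ L.higher) {r s t : NTm} (h : T.mem (.eq r s)) (h' : T.mem (.eq s t)) :
    T.mem (.eq r t) := by
  have hl := T.inLang h
  have hl' := T.inLang h'
  have := T.mem_of_eq hL (.eq (r.subst shiftN FTm.var) (.var 0))
    ⟨shift_inLang hl.1, trivial⟩ hl'.1 hl'.2 h'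
  simp only [instN_eq, Fml.subst, instN_lift] at this
  exact this h

theorem eq_app (hL : ¬ L.higher) {k : ℕ} {f : FTm k} (hf : f.InLang L) {s t : Fin k → NTm}
    (h : ∀ i, T.mem (.eq (s i) (t i))) : T.mem (.eq (.app f s) (.app f t)) := by
  have hs : ∀ i, (s i).InLang L := fun i => (T.inLang (h i)).1
  have ht : ∀ i, (t i).InLang L := fun i => (T.inLang (h i)).2
  -- Arguments are replaced one at a time, from the left; each replacement is one use of Leibniz's
  -- law.
  have key : ∀ m ≤ k, T.mem (.eq (.app f s) (.app f fun i => if i.1 < m then t i else s i)) := by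
    intro m
    induction m with
    | zero => intro _; simpa using T.eq_refl (t := .app f s) ⟨hf, hs⟩
    | succ m ih =>
      intro hm
      have hmix : ∀ i : Fin k, (if i.1 < m then t i else s i).InLang L := fun i => by
        split_ifs
        exacts [ht i, hs i]
      have := T.mem_of_eq hL (.eq ((NTm.app f s).subst shiftN FTm.var)
        (.app f fun i => if i.1 = m then .var 0 else
          (if i.1 < m then t i else s i).subst shiftN FTm.var))
        ⟨shift_inLang ⟨hf, hs⟩, hf, fun i => by
          dsimp only
          split_ifs
          · trivial
          · exact shift_inLang (ht i)
          · exact shift_inLang (hs i)⟩ (hs ⟨m, hm⟩) (ht ⟨m, hm⟩) (h ⟨m, hm⟩)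
      rw [instN_eq, instN_eq, Fml.subst, Fml.subst, instN_lift, instN_lift] at this
      simp only [NTm.subst, FTm.subst_var] at this
      convert this ?_ using 3
      · funext i
        by_cases h1 : i.1 = m
        · obtain rfl : i = ⟨m, hm⟩ := Fin.ext h1
          simp [NTm.subst, scons]
        · have : i.1 < m + 1 ↔ i.1 < m := by omega
          simp only [this, h1, if_false, instN_lift]
      · convert ih (Nat.le_of_succ_le hm) using 3
        funext i
        by_cases h1 : i.1 = m
        · obtain rfl : i = ⟨m, hm⟩ := Fin.ext h1
          simp [NTm.subst, scons]
        · simp only [h1, if_false, instN_lift]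
  simpa using key k le_rfl

/-- Provable equality of terms. -/
def setoid (hL : ¬ L.higher) : Setoid {t : NTm // t.InLang L} where
  r s t := T.mem (.eq s.1 t.1)
  iseqv := ⟨fun t => T.eq_refl t.2, T.eq_symm hL, T.eq_trans hL⟩

/-- The carrier of the term model. -/
def Carrier (hL : ¬ L.higher) : Type := Quotient (T.setoid hL)

/-- The element denoted by a term. -/
def cls (hL : ¬ L.higher) (t : NTm) (ht : t.InLang L) : T.Carrier hL :=
  Quotient.mk (T.setoid hL) ⟨t, ht⟩

open Classical in
/-- The term model. -/
noncomputable def str (hL : ¬ L.higher) : Str (T.Carrier hL) where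
  fn c v := if hc : L.fn c then
      T.cls hL (.app (.pr c) fun i => (v i).out.1) ⟨hc, fun i => (v i).out.2⟩
    else T.cls hL (.var 0) trivial
  dom _ := ∅
  fnl _ _ := T.cls hL (.var 0) trivial

theorem cls_eq_cls (hL : ¬ L.higher) {s t : NTm} (hs : s.InLang L) (ht : t.InLang L) :
    T.cls hL s hs = T.cls hL t ht ↔ T.mem (.eq s t) :=
  Quotient.eq (r := T.setoid hL)

/-- Identifiers are interpreted through chosen representatives; `eq_app` shows that the choice does
not affect the class. -/
theorem eval_eq (hL : ¬ L.higher) (ε : FEnv (T.Carrier hL)) {σ : ℕ → NTm}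
    (hσ : ∀ n, (σ n).InLang L) (t : NTm) (ht : t.InLang L) :
    t.eval (T.str hL) (fun n => T.cls hL (σ n) (hσ n)) ε =
      T.cls hL (t.subst σ FTm.var) (ht.subst hσ) := by
  induction t with
  | var n => rfl
  | app f args ih =>
    cases f with
    | var k n => exact absurd ht.1 hL
    | pr c =>
      have hc : L.fn c := ht.1
      simp only [NTm.eval, FTm.eval, ih _ (ht.2 _)]
      refine (dif_pos hc).trans ((T.cls_eq_cls hL _ _).2 (T.eq_app hL ht.1 fun i => ?_))
      exact Quotient.mk_out (s := T.setoid hL)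
        (⟨(args i).subst σ FTm.var, (ht.2 i).subst hσ⟩ : {t : NTm // t.InLang L})
    | fnl a b n args => exact absurd ht.1.1 hL

/-- The truth lemma. It is stated for an assignment by arbitrary terms `σ`, so that a quantifier
step only prepends a term. -/
theorem sat_iff (hL : ¬ L.higher) (ε : FEnv (T.Carrier hL)) (φ : Fml) : φ.InLang L →
    ∀ {σ : ℕ → NTm} (hσ : ∀ n, (σ n).InLang L),
    Sat (T.str hL) (fun n => T.cls hL (σ n) (hσ n)) ε φ ↔ T.mem (φ.subst σ FTm.var) := by
  induction φ with
  | eq s t =>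
    intro hφ σ hσ
    rw [Sat, T.eval_eq hL ε hσ s hφ.1, T.eval_eq hL ε hσ t hφ.2, cls_eq_cls]
    rfl
  | feq f g => exact fun h => absurd h.1 hL
  | bot => exact fun _ _ _ => ⟨False.elim, T.not_bot⟩
  | imp φ ψ ih₁ ih₂ =>
    intro hφ σ hσ
    rw [Sat, ih₁ hφ.1, ih₂ hφ.2, ← T.mem_imp (Fml.subst_inLang hL hσ hφ.1)
      (Fml.subst_inLang hL hσ hφ.2)]
    rfl
  | all φ ih =>
    intro hφ σ hσ
    have hφ' : φ.InLang L := hφ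
    rw [Fml.subst, T.mem_all hL (Fml.subst_inLang hL (upN_inLang hσ) hφ')]
    simp only [Fml.instN_subst_upN hL hφ']
    have key : ∀ t (ht : t.InLang L), Sat (T.str hL)
        (scons (T.cls hL t ht) fun n => T.cls hL (σ n) (hσ n)) ε φ ↔
        T.mem (φ.subst (scons t σ) FTm.var) := by
      intro t ht
      rw [← ih hφ' (scons_inLang hσ ht)]
      refine iff_of_eq (congrArg (fun a => Sat _ a ε φ) ?_)
      funext n; cases n <;> rfl
    constructor
    · exact fun h t ht => (key t ht).1 (h _)
    · intro h x
      obtain ⟨⟨t, ht⟩, rfl⟩ := Quotient.exists_rep x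
      exact (key t ht).2 (h t ht)
  | fall k φ ih => exact fun h => absurd h.1 hL

end Henkin

/-- Gödel's completeness theorem for first-order theories. -/
theorem completeness (hL : ¬ L.higher) {φ : Fml} (hφ : φ.InLang L)
    (h : ∀ (M : Type) [Countable M] (S : Str M),
      (∀ ψ ∈ Ax, ψ.InLang L → ∀ e ε, Sat S e ε ψ) → ∀ e ε, Sat S e ε φ) :
    Provable L Ax φ := by
  by_contra hn
  obtain ⟨T, hT⟩ := exists_henkin hL hφ hn
  have : Countable (T.Carrier hL) := inferInstanceAs (Countable (Quotient (T.setoid hL)))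
  -- Every assignment picks classes of terms, so an axiom holds under it because its substitution
  -- instances are provable.
  have h1 := h (T.Carrier hL) (T.str hL) (fun ψ hψ hl e ε => by
    have : ∃ (σ : ℕ → NTm) (hσ : ∀ n, (σ n).InLang L), e = fun n => T.cls hL (σ n) (hσ n) :=
      ⟨fun n => (e n).out.1, fun n => (e n).out.2, funext fun n => ((e n).out_eq).symm⟩
    obtain ⟨σ, hσ, rfl⟩ := this
    exact (T.sat_iff hL ε ψ hl hσ).2 (T.of_provable ((Provable.ax hψ hl).subst hL hσ)))
    (fun n => T.cls hL (.var n) trivial) (fun k _ => (T.str hL).fnl k)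
  rw [T.sat_iff hL _ φ hφ NTm.var_inLang, Fml.subst_var hL hφ] at h1
  exact T.not_bot (T.mp hT h1)

end Arith

namespace Arith

/-! ### Models of arithmetic with a notion of definability -/

/-- Polynomial functions with parameters. -/
class inductive IsPoly {M : Type} [CommSemiring M] {n : ℕ} : ((Fin n → M) → M) → Prop
  | var (i : Fin n) : IsPoly fun v => v i
  | const (c : M) : IsPoly fun _ => c
  | add {f g : (Fin n → M) → M} : IsPoly f → IsPoly g → IsPoly fun v => f v + g v
  | mul {f g : (Fin n → M) → M} : IsPoly f → IsPoly g → IsPoly fun v => f v * g v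

/-- A model of Peano arithmetic: a semiring with a class of predicates, closed under first-order
definitions, for which induction holds. -/
class ArithModel (M : Type) extends CommSemiring M where
  Def : ∀ {n : ℕ}, ((Fin n → M) → Prop) → Prop
  def_eq : ∀ {n : ℕ} {f g : (Fin n → M) → M}, IsPoly f → IsPoly g → Def fun v => f v = g v
  def_imp : ∀ {n : ℕ} {P Q : (Fin n → M) → Prop}, Def P → Def Q → Def fun v => P v → Q v
  def_all : ∀ {n : ℕ} {P : (Fin (n + 1) → M) → Prop}, Def P →
    Def fun v : Fin n → M => ∀ x : M, P (Fin.cons x v)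
  def_comp : ∀ {k n : ℕ} {P : (Fin k → M) → Prop} {f : Fin k → (Fin n → M) → M}, Def P →
    (∀ i, IsPoly (f i)) → Def fun v => P fun i => f i v
  ind' : ∀ P : M → Prop, Def (fun v : Fin 1 → M => P (v 0)) → P 0 → (∀ x, P x → P (x + 1)) →
    ∀ x, P x
  succ_ne_zero' : ∀ x : M, x + 1 ≠ 0
  add_right_cancel' : ∀ x y z : M, x + z = y + z → x = y

/-- Definable predicates. -/
class IsDef {M : Type} [ArithModel M] {n : ℕ} (P : (Fin n → M) → Prop) : Prop where
  out : ArithModel.Def P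

namespace ArithModel

variable {M : Type}

/-! ### Definability by instance search -/

section
variable [CommSemiring M] {n : ℕ}

instance (i : Fin n) : IsPoly fun v : Fin n → M => v i := .var i

instance (c : M) : IsPoly fun _ : Fin n → M => c := .const c

instance (f g : (Fin n → M) → M) [hf : IsPoly f] [hg : IsPoly g] :
    IsPoly fun v => f v + g v := .add hf hg

instance (f g : (Fin n → M) → M) [hf : IsPoly f] [hg : IsPoly g] :
    IsPoly fun v => f v * g v := .mul hf hg

theorem isPoly_rename {k : ℕ} {f : (Fin k → M) → M} (hf : IsPoly f) (σ : Fin k → Fin n) :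
    IsPoly fun v : Fin n → M => f fun i => v (σ i) := by
  induction hf with
  | var i => exact .var (σ i)
  | const c => exact .const c
  | add _ _ h₁ h₂ => exact .add h₁ h₂
  | mul _ _ h₁ h₂ => exact .mul h₁ h₂

/-- Passing under a quantifier replaces `v` by `fun i => w i.succ`; this instance recognizes an
abstract polynomial after such a renaming. -/
instance (priority := low) {k : ℕ} (f : (Fin k → M) → M) [hf : IsPoly f] (σ : Fin k → Fin n) :
    IsPoly fun v : Fin n → M => f fun i => v (σ i) := isPoly_rename hf σ

end

variable [ArithModel M] {n : ℕ}

instance (f g : (Fin n → M) → M) [hf : IsPoly f] [hg : IsPoly g] :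
    IsDef fun v => f v = g v := ⟨def_eq hf hg⟩

instance (P Q : (Fin n → M) → Prop) [hP : IsDef P] [hQ : IsDef Q] :
    IsDef fun v => P v → Q v := ⟨def_imp hP.out hQ.out⟩

instance (P : M → (Fin n → M) → Prop)
    [h : IsDef fun w : Fin (n + 1) → M => P (w 0) fun i => w i.succ] :
    IsDef fun v => ∀ x, P x v := ⟨def_all h.out⟩

instance (priority := low) isDef_const (p : Prop) : IsDef fun _ : Fin n → M => p := by
  by_cases hp : p
  · have : IsDef fun _ : Fin n → M => (0 : M) = 0 := inferInstance
    simpa [hp] using this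
  · have : IsDef fun _ : Fin n → M => (0 + 1 : M) = 0 := inferInstance
    simpa only [hp, succ_ne_zero' (0 : M)] using this

instance (P : (Fin n → M) → Prop) [IsDef P] : IsDef fun v => ¬ P v :=
  inferInstanceAs (IsDef fun v => P v → False)

instance (P Q : (Fin n → M) → Prop) [hP : IsDef P] [hQ : IsDef Q] : IsDef fun v => P v ∧ Q v := by
  have : IsDef fun v => ¬ (P v → ¬ Q v) := inferInstance
  simpa using this

instance (P Q : (Fin n → M) → Prop) [hP : IsDef P] [hQ : IsDef Q] : IsDef fun v => P v ∨ Q v := by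
  have : IsDef fun v => ¬ P v → Q v := inferInstance
  simpa [or_iff_not_imp_left] using this

instance (P Q : (Fin n → M) → Prop) [hP : IsDef P] [hQ : IsDef Q] : IsDef fun v => P v ↔ Q v := by
  have : IsDef fun v => (P v → Q v) ∧ (Q v → P v) := inferInstance
  simpa [iff_def] using this

instance (P : M → (Fin n → M) → Prop)
    [h : IsDef fun w : Fin (n + 1) → M => P (w 0) fun i => w i.succ] :
    IsDef fun v => ∃ x, P x v := by
  have : IsDef fun v => ¬ ∀ x, ¬ P x v := inferInstance
  simpa using this

instance (f g : (Fin n → M) → M) [IsPoly f] [IsPoly g] : IsDef fun v => f v ∣ g v :=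
  inferInstanceAs (IsDef fun v => ∃ c, g v = f v * c)

theorem ind (P : M → Prop) [h : IsDef fun v : Fin 1 → M => P (v 0)] (h0 : P 0)
    (hs : ∀ x, P x → P (x + 1)) (x : M) : P x := ind' P h.out h0 hs x

theorem isDef_comp (X : M → Prop) [hX : IsDef fun v : Fin 1 → M => X (v 0)]
    (f : (Fin n → M) → M) [hf : IsPoly f] : IsDef fun v => X (f v) :=
  ⟨def_comp (f := fun _ => f) hX.out fun _ => hf⟩

/-! ### Elementary arithmetic -/

instance : IsCancelAdd M :=
  have : IsRightCancelAdd M := ⟨fun z x y h => add_right_cancel' x y z h⟩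
  have : IsLeftCancelAdd M := ⟨fun z x y h => add_right_cancel (b := z) (by
    simpa [add_comm] using h)⟩
  {}

theorem succ_ne_zero (x : M) : x + 1 ≠ 0 := succ_ne_zero' x

theorem eq_zero_or_succ (x : M) : x = 0 ∨ ∃ y, x = y + 1 := by
  refine ind (fun x => x = 0 ∨ ∃ y, x = y + 1) ?_ ?_ x
  · exact .inl rfl
  · exact fun x _ => .inr ⟨x, rfl⟩

theorem eq_zero_of_add {a b : M} (h : a + b = 0) : b = 0 := by
  obtain rfl | ⟨c, rfl⟩ := eq_zero_or_succ b
  · rfl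
  · exact absurd (by rw [← h]; ring) (succ_ne_zero (a + c))

theorem add_succ_ne_self (a b : M) : a + (b + 1) ≠ a :=
  fun h => succ_ne_zero b (add_left_cancel (a := a) (by rw [h, add_zero]))

/-- The strict order. -/
def Lt (x y : M) : Prop := ∃ t, y = x + t + 1

instance (f g : (Fin n → M) → M) [IsPoly f] [IsPoly g] : IsDef fun v => Lt (f v) (g v) :=
  inferInstanceAs (IsDef fun v => ∃ t, g v = f v + t + 1)

theorem not_lt_zero (x : M) : ¬ Lt x 0 := fun ⟨t, ht⟩ => succ_ne_zero (x + t) ht.symm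

theorem lt_trichotomy (x y : M) : Lt x y ∨ x = y ∨ Lt y x := by
  refine ind (fun x => Lt x y ∨ x = y ∨ Lt y x) ?_ ?_ x
  · obtain rfl | ⟨z, rfl⟩ := eq_zero_or_succ y
    · exact .inr (.inl rfl)
    · exact .inl ⟨z, by ring⟩
  · rintro x (⟨t, rfl⟩ | rfl | ⟨t, rfl⟩)
    · obtain rfl | ⟨s, rfl⟩ := eq_zero_or_succ t
      · exact .inr (.inl (by ring))
      · exact .inl ⟨s, by ring⟩
    · exact .inr (.inr ⟨0, by ring⟩)
    · exact .inr (.inr ⟨t + 1, by ring⟩)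

theorem lt_succ_iff (x y : M) : Lt x (y + 1) ↔ Lt x y ∨ x = y := by
  constructor
  · rintro ⟨t, ht⟩
    have ht := add_right_cancel ht
    obtain rfl | ⟨s, rfl⟩ := eq_zero_or_succ t
    · exact .inr (by rw [ht, add_zero])
    · exact .inl ⟨s, by rw [ht]; ring⟩
  · rintro (⟨t, rfl⟩ | rfl)
    · exact ⟨t + 1, by ring⟩
    · exact ⟨0, by ring⟩

/-- There is no subtraction: the two quotients are compared and the common part is cancelled. -/
theorem dvd_of_dvd_add {d a b : M} (h₁ : d ∣ a) (h₂ : d ∣ a + b) : d ∣ b := by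
  obtain ⟨x, rfl⟩ := h₁
  obtain ⟨y, hy⟩ := h₂
  obtain ⟨t, rfl⟩ | rfl | ⟨t, rfl⟩ := lt_trichotomy x y
  · exact ⟨t + 1, add_left_cancel (a := d * x) (by rw [hy]; ring)⟩
  · have : b = 0 := add_left_cancel (a := d * x) (by rw [hy, add_zero])
    exact this ▸ dvd_zero d
  · have : d * (t + 1) + b = 0 := add_left_cancel (a := d * y) (by
      rw [add_zero]; exact Eq.trans (by ring) hy)
    exact eq_zero_of_add this ▸ dvd_zero d

/-! ### Pairs -/

/-- The code of a pair. -/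
def pair (a b : M) : M := (a + b) * (a + b) + a

instance (f g : (Fin n → M) → M) [IsPoly f] [IsPoly g] : IsPoly fun v => pair (f v) (g v) :=
  inferInstanceAs (IsPoly fun v => (f v + g v) * (f v + g v) + f v)

/-- The code of `(a, b)` lies from the square of `a + b` up to, but excluding, the next square. So
different sums give different codes. The pairing is not onto, which is why non-pairs need clauses of
their own in `EvBase`. -/
theorem pair_lt {a b c d t : M} (h : c + d = a + b + t + 1) : pair a b ≠ pair c d := by
  intro he
  unfold pair at he
  rw [h] at he
  exact add_succ_ne_self ((a + b) * (a + b) + a) (a + b + b + t * (2 * (a + b) + t + 2) + c)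
    (Eq.trans (by ring) he.symm)

theorem pair_inj {a b c d : M} : pair a b = pair c d ↔ a = c ∧ b = d := by
  refine ⟨fun h => ?_, fun ⟨h₁, h₂⟩ => by rw [h₁, h₂]⟩
  obtain ⟨t, ht⟩ | he | ⟨t, ht⟩ := lt_trichotomy (a + b) (c + d)
  · exact absurd h (pair_lt ht)
  · have hac : a = c := add_left_cancel (a := (a + b) * (a + b)) (by
      have := h; unfold pair at this; rw [this, he])
    subst hac
    exact ⟨rfl, add_left_cancel he⟩
  · exact absurd h.symm (pair_lt ht)

/-! ### Codes of finite sets -/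

/-- Divisors `1 + (w + 1) (a + 1)` for `w < B` are pairwise relatively prime if `a + 1` is a
multiple of `1, …, B`. -/
theorem dvd_of_dvd_mul {B a w z p : M} (ha : ∀ t, Lt t B → t + 1 ∣ a + 1) (hw : Lt w B)
    (hz : Lt z B) (hwz : w ≠ z) (h : 1 + (w + 1) * (a + 1) ∣ p * (1 + (z + 1) * (a + 1))) :
    1 + (w + 1) * (a + 1) ∣ p := by
  -- With `A = a + 1`, the combination `(z + 1)(1 + (w + 1)A) - (w + 1)(1 + (z + 1)A)` is `z - w`.
  -- So the divisor divides `p` times the distance of `w` and `z`, which is below `B` and hence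
  -- divides `A`.
  have key : ∃ k, Lt k B ∧ 1 + (w + 1) * (a + 1) ∣ p * (k + 1) := by
    obtain ⟨t, rfl⟩ | he | ⟨t, rfl⟩ := lt_trichotomy w z
    · obtain ⟨s, rfl⟩ := hz
      refine ⟨t, ⟨w + s + 1, by ring⟩, dvd_of_dvd_add (h.mul_left (w + 1)) ?_⟩
      exact ⟨p * (w + t + 1 + 1), by ring⟩
    · exact absurd he hwz
    · obtain ⟨s, rfl⟩ := hw
      refine ⟨t, ⟨z + s + 1, by ring⟩, dvd_of_dvd_add
        (a := p * (z + 1) * (1 + (z + t + 1 + 1) * (a + 1))) (Dvd.intro_left _ rfl) ?_⟩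
      convert h.mul_left (z + t + 1 + 1) using 1
      ring
  obtain ⟨k, hk, hd⟩ := key
  obtain ⟨l, hl⟩ := ha k hk
  refine dvd_of_dvd_add (hd.mul_left (l * (w + 1))) ⟨p, ?_⟩
  rw [hl]; ring

theorem exists_multiple (B : M) : ∃ a : M, ∀ t, Lt t B → t + 1 ∣ a + 1 := by
  refine ind (fun B => ∃ a : M, ∀ t, Lt t B → t + 1 ∣ a + 1) ?_ ?_ B
  · exact ⟨0, fun t ht => absurd ht (not_lt_zero t)⟩
  · rintro B ⟨a, ha⟩
    -- The successor of this witness is `(a + 1) * (B + 1)`, as in a factorial.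
    refine ⟨a * B + a + B, fun t ht => ?_⟩
    have e : a * B + a + B + 1 = (a + 1) * (B + 1) := by ring
    rw [e]
    obtain h | rfl := (lt_succ_iff t B).1 ht
    · exact (ha t h).mul_right _
    · exact Dvd.intro_left _ rfl

/-- Multiply the divisors that belong to the elements of `X` below `b`, by induction on `b` with `B`
fixed. By `dvd_of_dvd_mul`, a new factor adds no other divisor of the list. -/
theorem exists_product (X : M → Prop) [IsDef fun v : Fin 1 → M => X (v 0)] {B a : M}
    (ha : ∀ t, Lt t B → t + 1 ∣ a + 1) (b : M) :
    ∃ p, ∀ w, Lt w B → (1 + (w + 1) * (a + 1) ∣ p ↔ Lt w b ∧ X w) := by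
  have : ∀ {n : ℕ} (f : (Fin n → M) → M) [IsPoly f], IsDef fun v => X (f v) :=
    fun f _ => isDef_comp X f
  refine ind (fun b => ∃ p, ∀ w, Lt w B → (1 + (w + 1) * (a + 1) ∣ p ↔ Lt w b ∧ X w)) ?_ ?_ b
  · refine ⟨1, fun w hw => ⟨fun ⟨q, hq⟩ => ?_, fun h => absurd h.1 (not_lt_zero w)⟩⟩
    obtain rfl | ⟨r, rfl⟩ := eq_zero_or_succ q
    · exact absurd (by simpa using hq) (succ_ne_zero (0 : M))
    · exact absurd (hq.trans (by ring)).symm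
        (add_succ_ne_self 1 (r + (w * a + w + a) * (r + 1) + r))
  · rintro b ⟨p, hp⟩
    by_cases h : Lt b B ∧ X b
    · refine ⟨p * (1 + (b + 1) * (a + 1)), fun w hw => ?_⟩
      rw [lt_succ_iff]
      by_cases hwb : w = b
      · subst hwb
        exact ⟨fun _ => ⟨.inr rfl, h.2⟩, fun _ => Dvd.intro_left _ rfl⟩
      · constructor
        · intro hd
          have := (hp w hw).1 (dvd_of_dvd_mul ha hw h.1 hwb hd)
          exact ⟨.inl this.1, this.2⟩
        · rintro ⟨h1 | h1, h2⟩
          · exact ((hp w hw).2 ⟨h1, h2⟩).mul_right _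
          · exact absurd h1 hwb
    · refine ⟨p, fun w hw => ?_⟩
      rw [hp w hw, lt_succ_iff]
      refine ⟨fun h => ⟨.inl h.1, h.2⟩, ?_⟩
      rintro ⟨h1 | rfl, h2⟩
      · exact ⟨h1, h2⟩
      · exact absurd ⟨hw, h2⟩ h

/-- Membership in the finite set with code `c`. -/
def Mem (w c : M) : Prop :=
  ∃ B a p, c = pair B (pair a p) ∧ Lt w B ∧ 1 + (w + 1) * (a + 1) ∣ p

instance (f g : (Fin n → M) → M) [IsPoly f] [IsPoly g] : IsDef fun v => Mem (f v) (g v) := by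
  unfold Mem; infer_instance

/-- Comprehension for bounded definable sets. The bound is stored in the code, as divisibility is
controlled only below it. -/
theorem exists_code (X : M → Prop) [IsDef fun v : Fin 1 → M => X (v 0)] (B : M) :
    ∃ c : M, ∀ w, Mem w c ↔ Lt w B ∧ X w := by
  obtain ⟨a, ha⟩ := exists_multiple B
  obtain ⟨p, hp⟩ := exists_product X ha B
  refine ⟨pair B (pair a p), fun w => ⟨?_, fun h => ⟨B, a, p, rfl, h.1, (hp w h.1).2 h⟩⟩⟩
  rintro ⟨B', a', p', he, hlt, hd⟩
  rw [pair_inj, pair_inj] at he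
  obtain ⟨rfl, rfl, rfl⟩ := he
  exact (hp w hlt).1 hd

theorem exists_bound (c : M) : ∃ B : M, ∀ w, Mem w c → Lt w B := by
  by_cases h : ∃ B d, c = pair B d
  · obtain ⟨B, d, rfl⟩ := h
    refine ⟨B, ?_⟩
    rintro w ⟨B', a, p, he, hlt, _⟩
    rw [(pair_inj.1 he).1]
    exact hlt
  · exact ⟨0, fun w ⟨B, a, p, he, _⟩ => absurd ⟨B, _, he⟩ h⟩

theorem exists_union (c d z : M) : ∃ u, ∀ w, Mem w u ↔ Mem w c ∨ Mem w d ∨ w = z := by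
  obtain ⟨B, hB⟩ := exists_bound c
  obtain ⟨C, hC⟩ := exists_bound d
  obtain ⟨u, hu⟩ := exists_code (fun w => Mem w c ∨ Mem w d ∨ w = z) (B + C + z + 1)
  refine ⟨u, fun w => (hu w).trans ⟨And.right, fun h => ⟨?_, h⟩⟩⟩
  obtain h | h | rfl := h
  · obtain ⟨t, rfl⟩ := hB w h; exact ⟨t + 1 + C + z, by ring⟩
  · obtain ⟨t, rfl⟩ := hC w h; exact ⟨B + t + 1 + z, by ring⟩
  · exact ⟨B + C, by ring⟩

/-! ### Inductive definitions -/

/-- The set inductively generated from `Base` by a rule `Step` with two premises. -/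
def Gen (Base : M → Prop) (Step : M → M → M → Prop) (t : M) : Prop :=
  ∃ c, (∀ s, Mem s c → Base s ∨ ∃ p q, Mem p c ∧ Mem q c ∧ Step p q s) ∧ Mem t c

/-- A derivation is a finite set in which every element is justified by others. Two derivations
combine by union together with the conclusion. Circular justification is not excluded, but only this
fixed-point equation is used. -/
theorem gen_iff {Base : M → Prop} {Step : M → M → M → Prop} {t : M} :
    Gen Base Step t ↔ Base t ∨ ∃ p q, Gen Base Step p ∧ Gen Base Step q ∧ Step p q t := by
  constructor
  · rintro ⟨c, hc, ht⟩
    obtain h | ⟨p, q, hp, hq, h⟩ := hc t ht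
    · exact .inl h
    · exact .inr ⟨p, q, ⟨c, hc, hp⟩, ⟨c, hc, hq⟩, h⟩
  · rintro (h | ⟨p, q, ⟨c, hc, hp⟩, ⟨d, hd, hq⟩, h⟩)
    · obtain ⟨u, hu⟩ := exists_code (fun w => w = t) (t + 1)
      refine ⟨u, fun s hs => .inl (((hu s).1 hs).2 ▸ h), (hu t).2 ⟨⟨0, by ring⟩, rfl⟩⟩
    · obtain ⟨u, hu⟩ := exists_union c d t
      refine ⟨u, fun s hs => ?_, (hu t).2 (.inr (.inr rfl))⟩
      obtain h1 | h1 | rfl := (hu s).1 hs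
      · exact (hc s h1).imp_right fun ⟨p, q, hp, hq, h⟩ =>
          ⟨p, q, (hu p).2 (.inl hp), (hu q).2 (.inl hq), h⟩
      · exact (hd s h1).imp_right fun ⟨p, q, hp, hq, h⟩ =>
          ⟨p, q, (hu p).2 (.inr (.inl hp)), (hu q).2 (.inr (.inl hq)), h⟩
      · exact .inr ⟨p, q, (hu p).2 (.inl hp), (hu q).2 (.inr (.inl hq)), h⟩

end ArithModel
end Arith

namespace Arith
namespace ArithModel

variable {M : Type} [ArithModel M]

/-- Lets `simp` tell apart the numerals that tag the different kinds of codes. -/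
instance : CharZero M where
  cast_injective := by
    have key : ∀ m k : ℕ, (m : M) ≠ ((m + k + 1 : ℕ) : M) := fun m k h =>
      add_succ_ne_self (m : M) (k : M) (by rw [← add_assoc]; exact_mod_cast h.symm)
    intro m n h
    rcases Nat.lt_trichotomy m n with hlt | he | hlt
    · obtain ⟨k, rfl⟩ := Nat.exists_eq_add_of_lt hlt
      exact absurd h (key m k)
    · exact he
    · obtain ⟨k, rfl⟩ := Nat.exists_eq_add_of_lt hlt
      exact absurd h.symm (key n k)

/-! ### Codes of computable functions -/

/-- The code of a constant function. -/
def constCode (a : M) : M := pair 0 a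

/-- The code of the successor. -/
def succCode : M := pair 1 0

/-- The code of the first projection from pairs. -/
def leftCode : M := pair 2 0

/-- The code of the second projection from pairs. -/
def rightCode : M := pair 3 0

/-- The code of the pairing of two functions. -/
def pairCode (a b : M) : M := pair 4 (pair a b)

/-- The code of a composition. -/
def compCode (a b : M) : M := pair 5 (pair a b)

/-- The code of a function defined by primitive recursion. -/
def recCode (a b : M) : M := pair 6 (pair a b)

/-- The statement that the function with code `e` has the value `y` at `x`. -/
def triple (e x y : M) : M := pair e (pair x y)

/-- Evaluations without premises.  Projections and recursions vanish at arguments that are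
not pairs. -/
def EvBase (t : M) : Prop :=
  (∃ a x, t = triple (pair 0 a) x a) ∨
  (∃ x, t = triple (pair 1 0) x (x + 1)) ∨
  (∃ x y, t = triple (pair 2 0) (pair x y) x) ∨
  (∃ x y, t = triple (pair 3 0) (pair x y) y) ∨
  (∃ x, (∀ a b, x ≠ pair a b) ∧ t = triple (pair 2 0) x 0) ∨
  (∃ x, (∀ a b, x ≠ pair a b) ∧ t = triple (pair 3 0) x 0) ∨
  (∃ x, (∀ a b, x ≠ pair a b) ∧ ∃ a b, t = triple (pair 6 (pair a b)) x 0)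

/-- Evaluations from the premises `p` and `q`. -/
def EvStep (p q t : M) : Prop :=
  (∃ a b x y z, t = triple (pair 4 (pair a b)) x (pair y z) ∧ p = triple a x y ∧ q = triple b x z) ∨
  (∃ a b x y z, t = triple (pair 5 (pair a b)) x z ∧ p = triple b x y ∧ q = triple a y z) ∨
  (∃ a b x y, t = triple (pair 6 (pair a b)) (pair 0 x) y ∧ p = triple a x y) ∨
  (∃ a b n x y z, t = triple (pair 6 (pair a b)) (pair (n + 1) x) z ∧
    p = triple (pair 6 (pair a b)) (pair n x) y ∧ q = triple b (pair n (pair y x)) z)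

/-- The partial function with code `e` has the value `y` at `x`. -/
def Ev (e x y : M) : Prop := Gen EvBase EvStep (triple e x y)

instance {n : ℕ} (f g h : (Fin n → M) → M) [IsPoly f] [IsPoly g] [IsPoly h] :
    IsPoly fun v => triple (f v) (g v) (h v) := by
  unfold triple; infer_instance

instance {n : ℕ} (f : (Fin n → M) → M) [IsPoly f] : IsDef fun v => EvBase (f v) := by
  unfold EvBase; infer_instance

set_option synthInstance.maxHeartbeats 200000 in
set_option synthInstance.maxSize 1000 in
instance {n : ℕ} (f g h : (Fin n → M) → M) [IsPoly f] [IsPoly g] [IsPoly h] :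
    IsDef fun v => EvStep (f v) (g v) (h v) := by
  unfold EvStep; infer_instance

instance {n : ℕ} (f g h : (Fin n → M) → M) [IsPoly f] [IsPoly g] [IsPoly h] :
    IsDef fun v => Ev (f v) (g v) (h v) := by
  unfold Ev Gen; infer_instance

/-- Here and in the following lemmas `gen_iff` is unfolded once; the tag of the code, and the shape
of the argument, leave a single applicable clause. -/
theorem ev_const {a x y : M} : Ev (constCode a) x y ↔ y = a := by
  rw [Ev, gen_iff]
  simp [EvBase, EvStep, constCode, triple, pair_inj, eq_comm]

theorem ev_succ {x y : M} : Ev succCode x y ↔ y = x + 1 := by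
  rw [Ev, gen_iff]
  simp [EvBase, EvStep, succCode, triple, pair_inj]

theorem ev_left {a b y : M} : Ev leftCode (pair a b) y ↔ y = a := by
  rw [Ev, gen_iff]
  simp [EvBase, EvStep, leftCode, triple, pair_inj]

theorem ev_left' {x y : M} (hx : ∀ a b, x ≠ pair a b) : Ev leftCode x y ↔ y = 0 := by
  rw [Ev, gen_iff]
  simp [EvBase, EvStep, leftCode, triple, pair_inj, hx]

theorem ev_right {a b y : M} : Ev rightCode (pair a b) y ↔ y = b := by
  rw [Ev, gen_iff]
  simp [EvBase, EvStep, rightCode, triple, pair_inj]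
  exact eq_comm

theorem ev_right' {x y : M} (hx : ∀ a b, x ≠ pair a b) : Ev rightCode x y ↔ y = 0 := by
  rw [Ev, gen_iff]
  simp [EvBase, EvStep, rightCode, triple, pair_inj, hx]

theorem ev_pair {a b x y : M} :
    Ev (pairCode a b) x y ↔ ∃ u v, Ev a x u ∧ Ev b x v ∧ y = pair u v := by
  rw [Ev, gen_iff]
  simp [EvBase, EvStep, pairCode, triple, pair_inj]
  rfl

theorem ev_comp {a b x y : M} :
    Ev (compCode a b) x y ↔ ∃ u, Ev b x u ∧ Ev a u y := by
  rw [Ev, gen_iff]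
  simp [EvBase, EvStep, compCode, triple, pair_inj]
  rfl

theorem ev_rec_zero {a b x y : M} : Ev (recCode a b) (pair 0 x) y ↔ Ev a x y := by
  rw [Ev, gen_iff]
  simp [EvBase, EvStep, recCode, triple, pair_inj, (succ_ne_zero _).symm]
  -- The clause for zero ignores its second premise, so the first one is supplied twice.
  exact ⟨And.left, fun h => ⟨h, _, h⟩⟩

theorem ev_rec_succ {a b n x y : M} : Ev (recCode a b) (pair (n + 1) x) y ↔
    ∃ u, Ev (recCode a b) (pair n x) u ∧ Ev b (pair n (pair u x)) y := by
  rw [Ev, gen_iff]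
  simp [EvBase, EvStep, recCode, triple, pair_inj, succ_ne_zero]
  rfl

theorem ev_rec' {a b x y : M} (hx : ∀ a b, x ≠ pair a b) : Ev (recCode a b) x y ↔ y = 0 := by
  rw [Ev, gen_iff]
  simp [EvBase, EvStep, recCode, triple, pair_inj, hx]

end ArithModel
end Arith

namespace Arith
namespace ArithModel

variable {M : Type} [ArithModel M]

/-! ### Total codes -/

/-- The code defines a total function. -/
def Tot (e : M) : Prop := ∀ x, ∃ y, ∀ z, Ev e x z ↔ z = y

instance {n : ℕ} (f : (Fin n → M) → M) [IsPoly f] : IsDef fun v => Tot (f v) := by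
  unfold Tot; infer_instance

open Classical in
/-- The total function with code `e`; zero if `e` does not define a total function. -/
noncomputable def dec (e x : M) : M := if h : Tot e then (h x).choose else 0

theorem ev_iff {e : M} (h : Tot e) {x y : M} : Ev e x y ↔ y = dec e x := by
  rw [dec, dif_pos h]
  exact (h x).choose_spec y

/-- `dec` is defined by choice; this expresses its graph through `Tot` and `Ev`, which are
definable. -/
theorem eq_dec_iff {e x y : M} : y = dec e x ↔ (Tot e ∧ Ev e x y) ∨ (¬ Tot e ∧ y = 0) := by
  by_cases h : Tot e
  · simp [h, ev_iff h]
  · simp [h, dec]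

instance {n : ℕ} (f g h : (Fin n → M) → M) [IsPoly f] [IsPoly g] [IsPoly h] :
    IsDef fun v => f v = dec (g v) (h v) := by
  simp only [eq_dec_iff]; infer_instance

theorem tot_dec_of_ev {e : M} {F : M → M} (h : ∀ x y, Ev e x y ↔ y = F x) :
    Tot e ∧ ∀ x, dec e x = F x := by
  have ht : Tot e := fun x => ⟨F x, h x⟩
  exact ⟨ht, fun x => ((h x _).1 ((ev_iff ht).2 rfl))⟩

theorem tot_const (a : M) : Tot (constCode a) ∧ ∀ x, dec (constCode a) x = a :=
  tot_dec_of_ev fun _ _ => ev_const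

theorem tot_succ : Tot (succCode : M) ∧ ∀ x, dec (succCode : M) x = x + 1 :=
  tot_dec_of_ev fun _ _ => ev_succ

theorem tot_left : Tot (leftCode : M) ∧ ∀ a b, dec (leftCode : M) (pair a b) = a := by
  have ht : Tot (leftCode : M) := by
    intro x
    by_cases h : ∃ a b, x = pair a b
    · obtain ⟨a, b, rfl⟩ := h
      exact ⟨a, fun _ => ev_left⟩
    · push Not at h
      exact ⟨0, fun _ => ev_left' h⟩
  exact ⟨ht, fun a b => ev_left.1 ((ev_iff ht).2 rfl)⟩

theorem tot_right : Tot (rightCode : M) ∧ ∀ a b, dec (rightCode : M) (pair a b) = b := by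
  have ht : Tot (rightCode : M) := by
    intro x
    by_cases h : ∃ a b, x = pair a b
    · obtain ⟨a, b, rfl⟩ := h
      exact ⟨b, fun _ => ev_right⟩
    · push Not at h
      exact ⟨0, fun _ => ev_right' h⟩
  exact ⟨ht, fun a b => ev_right.1 ((ev_iff ht).2 rfl)⟩

theorem tot_pair {a b : M} (ha : Tot a) (hb : Tot b) :
    Tot (pairCode a b) ∧ ∀ x, dec (pairCode a b) x = pair (dec a x) (dec b x) :=
  tot_dec_of_ev fun _ _ => by simp [ev_pair, ev_iff ha, ev_iff hb]

theorem tot_comp {a b : M} (ha : Tot a) (hb : Tot b) :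
    Tot (compCode a b) ∧ ∀ x, dec (compCode a b) x = dec a (dec b x) :=
  tot_dec_of_ev fun _ _ => by simp [ev_comp, ev_iff ha, ev_iff hb]

/-- Induction in the model on the recursion argument. It is available because `Ev` is definable, and
it reaches nonstandard arguments. -/
theorem tot_rec {a b : M} (ha : Tot a) (hb : Tot b) : Tot (recCode a b) := by
  intro x
  by_cases h : ∃ n y, x = pair n y
  · obtain ⟨n, x, rfl⟩ := h
    refine ind (fun n => ∃ y, ∀ z, Ev (recCode a b) (pair n x) z ↔ z = y) ?_ ?_ n
    · exact ⟨dec a x, fun z => by rw [ev_rec_zero, ev_iff ha]⟩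
    · rintro n ⟨y, hy⟩
      exact ⟨dec b (pair n (pair y x)), fun z => by simp [ev_rec_succ, hy, ev_iff hb]⟩
  · push Not at h
    exact ⟨0, fun _ => ev_rec' h⟩

theorem dec_rec_zero {a b : M} (ha : Tot a) (hb : Tot b) (x : M) :
    dec (recCode a b) (pair 0 x) = dec a x := by
  rw [← ev_iff ha, ← ev_rec_zero (b := b), ev_iff (tot_rec ha hb)]

theorem dec_rec_succ {a b : M} (ha : Tot a) (hb : Tot b) (n x : M) :
    dec (recCode a b) (pair (n + 1) x) =
      dec b (pair n (pair (dec (recCode a b) (pair n x)) x)) := by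
  have h := (ev_iff (tot_rec ha hb) (x := pair (n + 1) x)).2 rfl
  rw [ev_rec_succ] at h
  obtain ⟨u, hu, h⟩ := h
  rw [ev_iff (tot_rec ha hb)] at hu
  rw [ev_iff hb, hu] at h
  exact h

/-! ### Tuples -/

/-- The code of a tuple. -/
def tup : {k : ℕ} → (Fin k → M) → M
  | 0, _ => 0
  | _ + 1, v => pair (v 0) (tup fun i => v i.succ)

/-- The code of the `i`-th projection from tuples. -/
def projCode : ℕ → M
  | 0 => leftCode
  | i + 1 => compCode (projCode i) rightCode

/-- The code of the function whose values are the tuples of the values of given functions. -/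
def tupCode : {k : ℕ} → (Fin k → M) → M
  | 0, _ => constCode 0
  | _ + 1, c => pairCode (c 0) (tupCode fun i => c i.succ)

theorem tot_proj (i : ℕ) : Tot (projCode i : M) := by
  induction i with
  | zero => exact tot_left.1
  | succ i ih => exact (tot_comp ih tot_right.1).1

theorem dec_proj {k : ℕ} (v : Fin k → M) (i : Fin k) : dec (projCode i.1) (tup v) = v i := by
  induction k with
  | zero => exact i.elim0
  | succ k ih =>
    obtain rfl | ⟨i, rfl⟩ := Fin.eq_zero_or_eq_succ i
    · exact tot_left.2 _ _
    · rw [Fin.val_succ, projCode, (tot_comp (tot_proj _) tot_right.1).2, tup, tot_right.2]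
      exact ih _ i

theorem tot_tup {k : ℕ} {c : Fin k → M} (hc : ∀ i, Tot (c i)) :
    Tot (tupCode c) ∧ ∀ x, dec (tupCode c) x = tup fun i => dec (c i) x := by
  induction k with
  | zero => exact tot_const 0
  | succ k ih =>
    have h := ih fun i => hc i.succ
    refine ⟨(tot_pair (hc 0) h.1).1, fun x => ?_⟩
    rw [tupCode, (tot_pair (hc 0) h.1).2, h.2, tup]

/-! ### Primitive recursive functions -/

/-- The code of a primitive recursive function, acting on tuples. -/
def prCode : {k : ℕ} → PR k → M
  | _, .zero => constCode 0
  | _, .succ => compCode succCode leftCode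
  | _, .proj i => projCode i.1
  | _, .comp f g => compCode (prCode f) (tupCode fun i => prCode (g i))
  | _, .prec f g => recCode (prCode f) (prCode g)

theorem tot_pr {k : ℕ} (c : PR k) : Tot (prCode c : M) := by
  induction c with
  | zero => exact (tot_const 0).1
  | succ => exact (tot_comp tot_succ.1 tot_left.1).1
  | proj i => exact tot_proj i.1
  | comp f g ihf ihg => exact (tot_comp ihf (tot_tup ihg).1).1
  | prec f g ihf ihg => exact tot_rec ihf ihg

/-- The value of a primitive recursive function. -/
noncomputable def prVal {k : ℕ} (c : PR k) (v : Fin k → M) : M := dec (prCode c) (tup v)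

theorem prVal_zero (v : Fin 0 → M) : prVal .zero v = 0 := (tot_const 0).2 _

theorem prVal_succ (v : Fin 1 → M) : prVal .succ v = v 0 + 1 := by
  rw [prVal, prCode, (tot_comp tot_succ.1 tot_left.1).2, tup, tot_left.2, tot_succ.2]

theorem prVal_proj {n : ℕ} (i : Fin n) (v : Fin n → M) : prVal (.proj i) v = v i := dec_proj v i

theorem prVal_comp {m n : ℕ} (f : PR m) (g : Fin m → PR n) (v : Fin n → M) :
    prVal (.comp f g) v = prVal f fun i => prVal (g i) v := by
  have h := tot_tup fun i => tot_pr (M := M) (g i)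
  rw [prVal, prCode, (tot_comp (tot_pr f) h.1).2, h.2]
  rfl

theorem prVal_prec_zero {n : ℕ} (f : PR n) (g : PR (n + 2)) (v : Fin n → M) :
    prVal (.prec f g) (Matrix.vecCons 0 v) = prVal f v :=
  dec_rec_zero (tot_pr f) (tot_pr g) _

theorem prVal_prec_succ {n : ℕ} (f : PR n) (g : PR (n + 2)) (x : M) (v : Fin n → M) :
    prVal (.prec f g) (Matrix.vecCons (x + 1) v) =
      prVal g (Matrix.vecCons x (Matrix.vecCons (prVal (.prec f g) (Matrix.vecCons x v)) v)) :=
  dec_rec_succ (tot_pr f) (tot_pr g) _ _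

/-! ### The structure for the extended language -/

/-- Primitive recursive functions, with the functions that have a code as the range of the
function variables. -/
noncomputable def str (M : Type) [ArithModel M] : Str M where
  fn := prVal
  dom _ := {f | ∃ e, f = fun v => dec e (tup v)}
  -- The constant zero function has a code, so it is an admissible value for applied functional
  -- variables.
  fnl _ _ := 0

/-- The assignment of functions given by an assignment of codes. -/
noncomputable def fenv (b : ∀ _ : ℕ, ℕ → M) : FEnv M := fun k n v => dec (b k n) (tup v)

theorem fenv_apply (b : ∀ _ : ℕ, ℕ → M) (k n : ℕ) :
    fenv b k n = fun v => dec (b k n) (tup v) := rfl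

/-- The code of the value of a term for a function. -/
def fcode (b : ∀ _ : ℕ, ℕ → M) : {k : ℕ} → FTm k → M
  | k, .var _ n => b k n
  | _, .pr c => prCode c
  | _, .fnl _ _ _ _ => constCode 0

theorem eval_fenv (b : ∀ _ : ℕ, ℕ → M) {k : ℕ} (f : FTm k) :
    f.eval (str M) (fenv b) = fun v => dec (fcode b f) (tup v) := by
  cases f with
  | var k n => rfl
  | pr c => rfl
  | fnl a b n args => exact funext fun v => ((tot_const 0).2 _).symm

theorem exists_fenv {ε : FEnv M} (h : ε.Ok (str M)) : ∃ b, ε = fenv b := by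
  choose b hb using h
  exact ⟨b, funext fun k => funext fun n => hb k n⟩

/-- A code that is not total decodes to zero, but a composition with it need not decode to the
composed function. A total code of the same function avoids this. -/
theorem exists_tot (e : M) : ∃ e', Tot e' ∧ ∀ x, dec e' x = dec e x := by
  by_cases h : Tot e
  · exact ⟨e, h, fun _ => rfl⟩
  · exact ⟨constCode 0, (tot_const 0).1, fun x => by rw [(tot_const 0).2, dec, dif_neg h]⟩

/-- Functions defined by terms have codes. -/
theorem exists_code_term (e : ℕ → M) (b : ∀ _ : ℕ, ℕ → M) (k : ℕ) (t : NTm) :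
    ∃ c, Tot c ∧ ∀ v : Fin k → M, dec c (tup v) = t.eval (str M) (vapp v e) (fenv b) := by
  induction t with
  | var n =>
    by_cases h : n < k
    · exact ⟨projCode n, tot_proj n, fun v => by
        rw [NTm.eval, vapp, dif_pos h]; exact dec_proj v ⟨n, h⟩⟩
    · exact ⟨constCode (e (n - k)), (tot_const _).1, fun v => by
        rw [NTm.eval, vapp, dif_neg h, (tot_const _).2]⟩
  | app f args ih =>
    choose c hc hv using ih
    obtain ⟨d, hd, hde⟩ := exists_tot (fcode b f)
    have h := tot_tup hc
    refine ⟨compCode d (tupCode c), (tot_comp hd h.1).1, fun v => ?_⟩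
    rw [(tot_comp hd h.1).2, h.2, hde, NTm.eval, eval_fenv]
    simp only [hv]

/-! ### Definability of satisfaction -/

/-- Functions with a definable graph. -/
class IsDefFun {n : ℕ} (F : (Fin n → M) → M) : Prop where
  out : IsDef fun w : Fin (n + 1) → M => w 0 = F fun i => w i.succ

theorem IsDefFun.isDef {n m : ℕ} {F : (Fin n → M) → M} (hF : IsDefFun F)
    (σ : Fin n → Fin m) (y : (Fin m → M) → M) [hy : IsPoly y] :
    IsDef fun w : Fin m → M => y w = F fun i => w (σ i) :=
  ⟨def_comp (f := Fin.cases y fun i w => w (σ i)) hF.out.out fun i =>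
    Fin.cases hy (fun i => .var (σ i)) i⟩

instance (priority := low) {n m : ℕ} (F : (Fin n → M) → M) [hF : IsDefFun F]
    (σ : Fin n → Fin m) (y : (Fin m → M) → M) [IsPoly y] :
    IsDef fun w : Fin m → M => y w = F fun i => w (σ i) := hF.isDef σ y

theorem isDefFun_tup {k n : ℕ} {F : Fin k → (Fin n → M) → M} (hF : ∀ i, IsDefFun (F i)) :
    IsDefFun fun v => tup fun i => F i v := by
  induction k with
  | zero => exact ⟨inferInstanceAs (IsDef fun w : Fin (n + 1) → M => w 0 = 0)⟩
  | succ k ih =>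
    have := hF 0
    have h2 := ih fun i => hF i.succ
    -- Abstracting the function to a variable lets instance search use its definable graph without
    -- unfolding it.
    generalize hG : (fun v => tup fun i => F (Fin.succ i) v) = G at h2
    have h : IsDef fun w : Fin (n + 1) → M => ∃ a b, (a = F 0 fun i => w i.succ) ∧
      (b = G fun i => w i.succ) ∧ w 0 = pair a b := inferInstance
    subst hG
    exact ⟨by simpa [tup] using h⟩

/-- The code of a function term is the code assigned to a variable or a fixed element of the model.
-/
theorem isPoly_fcode {n k : ℕ} {b : ∀ _ : ℕ, ℕ → (Fin n → M) → M}
    (hb : ∀ k m, IsPoly (b k m)) (f : FTm k) : IsPoly fun v => fcode (fun k m => b k m v) f := by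
  cases f with
  | var k n => exact hb _ _
  | pr c => exact .const _
  | fnl a b n args => exact .const _

theorem isDefFun_eval {n : ℕ} {a : ℕ → (Fin n → M) → M} (ha : ∀ m, IsPoly (a m))
    {b : ∀ _ : ℕ, ℕ → (Fin n → M) → M} (hb : ∀ k m, IsPoly (b k m)) (t : NTm) :
    IsDefFun fun v => t.eval (str M) (fun m => a m v) (fenv fun k m => b k m v) := by
  induction t with
  | var m =>
    have := ha m
    exact ⟨inferInstanceAs (IsDef fun w : Fin (n + 1) → M => w 0 = a m fun i => w i.succ)⟩
  | app f args ih =>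
    have h1 := isDefFun_tup ih
    have h2 := isPoly_fcode hb f
    generalize hG : (fun v => tup fun i =>
      (args i).eval (str M) (fun m => a m v) (fenv fun k m => b k m v)) = G at h1
    generalize hC : (fun v => fcode (fun k m => b k m v) f) = C at h2
    have h : IsDef fun w : Fin (n + 1) → M => ∃ z, (z = G fun i => w i.succ) ∧
      w 0 = dec (C fun i => w i.succ) z := inferInstance
    subst hG hC
    exact ⟨by simpa [NTm.eval, eval_fenv] using h⟩

/-- The elements that are codes of `k`-tuples. -/
def IsTup : ℕ → M → Prop
  | 0, z => z = 0
  | k + 1, z => ∃ a b, z = pair a b ∧ IsTup k b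

theorem isTup_iff {k : ℕ} {z : M} : IsTup k z ↔ ∃ v : Fin k → M, z = tup v := by
  induction k generalizing z with
  | zero => exact ⟨fun h => ⟨Fin.elim0, h⟩, fun ⟨_, h⟩ => h⟩
  | succ k ih =>
    constructor
    · rintro ⟨a, b, rfl, h⟩
      obtain ⟨v, rfl⟩ := ih.1 h
      exact ⟨Fin.cons a v, rfl⟩
    · rintro ⟨v, rfl⟩
      exact ⟨_, _, rfl, ih.2 ⟨_, rfl⟩⟩

instance isDef_isTup (k : ℕ) : ∀ {n : ℕ} (f : (Fin n → M) → M) [IsPoly f],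
    IsDef fun v => IsTup k (f v) := by
  induction k with
  | zero => intro n f _; exact inferInstanceAs (IsDef fun v => f v = 0)
  | succ k ih =>
    intro n f _
    exact inferInstanceAs (IsDef fun v => ∃ a b, f v = pair a b ∧ IsTup k b)

/-- Satisfaction in the extended language is definable, as functions are given by codes. -/
theorem isDef_sat (φ : Fml) : ∀ {n : ℕ} {a : ℕ → (Fin n → M) → M} (_ : ∀ m, IsPoly (a m))
    {b : ∀ _ : ℕ, ℕ → (Fin n → M) → M} (_ : ∀ k m, IsPoly (b k m)),
    IsDef fun v => Sat (str M) (fun m => a m v) (fenv fun k m => b k m v) φ := by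
  induction φ with
  | eq s t =>
    intro n a ha b hb
    have h1 := isDefFun_eval ha hb s
    have h2 := isDefFun_eval ha hb t
    generalize hF : (fun v => s.eval (str M) (fun m => a m v) (fenv fun k m => b k m v)) = F at h1
    generalize hG : (fun v => t.eval (str M) (fun m => a m v) (fenv fun k m => b k m v)) = G at h2
    have h : IsDef fun v : Fin n → M => ∃ z, (z = F fun i => v i) ∧ (z = G fun i => v i) :=
      inferInstance
    subst hF hG
    simpa [Sat] using h
  | @feq k f g =>
    intro n a _ b hb
    have h1 := isPoly_fcode hb f
    have h2 := isPoly_fcode hb g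
    generalize hF : (fun v => fcode (fun k m => b k m v) f) = F at h1
    generalize hG : (fun v => fcode (fun k m => b k m v) g) = G at h2
    -- Equality of two functions is agreement at all codes of tuples, so one number quantifier
    -- replaces the tuple of arguments.
    have h : IsDef fun v : Fin n → M => ∀ z, IsTup k z → ∃ y, (y = dec (F fun i => v i) z) ∧
      (y = dec (G fun i => v i) z) := inferInstance
    subst hF hG
    have e : ∀ v : Fin n → M, (∀ z, IsTup k z → ∃ y,
        (y = dec (fcode (fun k m => b k m v) f) z) ∧ (y = dec (fcode (fun k m => b k m v) g) z)) ↔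
        Sat (str M) (fun m => a m v) (fenv fun k m => b k m v) (.feq f g) := by
      intro v
      simp only [exists_eq_left, isTup_iff, Sat, eval_fenv, funext_iff]
      exact ⟨fun h w => h _ ⟨w, rfl⟩, fun h z ⟨w, hw⟩ => hw ▸ h w⟩
    simpa only [e] using h
  | bot => intros; exact isDef_const False
  | imp φ ψ ih₁ ih₂ =>
    intro n a ha b hb
    exact ⟨def_imp (ih₁ ha hb).out (ih₂ ha hb).out⟩
  | all φ ih =>
    intro n a ha b hb
    have h := ih (n := n + 1) (a := scons (fun w => w 0) fun m w => a m fun i => w i.succ)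
      (fun m => by
        cases m with
        | zero => exact .var 0
        | succ m =>
          have := ha m
          exact inferInstanceAs (IsPoly fun w : Fin (n + 1) → M => a m fun i => w i.succ))
      (b := fun k m w => b k m fun i => w i.succ)
      (fun k m => by have := hb k m; exact inferInstance)
    refine ⟨?_⟩
    convert def_all h.out using 3 with v
    refine forall_congr' fun x => iff_of_eq ?_
    congr 1
    funext m; cases m <;> rfl
  | fall k φ ih =>
    intro n a ha b hb
    -- The quantified function is represented by its code, the new coordinate `w 0`, prepended to
    -- the assigned `k`-ary codes.
    have h := ih (n := n + 1) (a := fun m w => a m fun i => w i.succ)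
      (fun m => by have := ha m; exact inferInstance)
      (b := fun j m w => if j = k then scons (w 0) (fun m => b j m fun i => w i.succ) m
        else b j m fun i => w i.succ)
      (fun j m => by
        have := hb j
        by_cases hj : j = k
        · cases m with
          | zero => simpa [hj, scons] using IsPoly.var 0
          | succ m =>
            have := hb j m
            have h : IsPoly fun w : Fin (n + 1) → M => b j m fun i => w i.succ := inferInstance
            simpa [hj, scons] using h
        · have := hb j m
          have h : IsPoly fun w : Fin (n + 1) → M => b j m fun i => w i.succ := inferInstance
          simpa [hj] using h)
    refine ⟨?_⟩
    convert def_all h.out using 3 with v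
    have e : ∀ c : M, fcons (fun w : Fin k → M => dec c (tup w)) (fenv fun k m => b k m v) =
        fenv fun j m => if j = k then scons c (fun m => b j m v) m else b j m v := by
      intro c
      funext j m
      by_cases hj : j = k
      · subst hj; cases m <;> simp [fcons, fenv_apply, scons]
      · simp [fcons, fenv_apply, hj]
    constructor
    · intro hs c
      have := hs _ ⟨c, rfl⟩
      rw [e] at this
      exact this
    · rintro hs _ ⟨c, rfl⟩
      rw [e]
      exact hs c

end ArithModel
end Arith

namespace Arith

/-! ### The extended theory holds in every model of arithmetic -/

section
variable {M : Type} (S : Str M) (e : ℕ → M) (ε : FEnv M)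

theorem eval_vecCons {n : ℕ} (t : NTm) (x : Fin n → NTm) :
    (fun i => NTm.eval S e ε (Matrix.vecCons t x i)) =
      Matrix.vecCons (t.eval S e ε) fun i => (x i).eval S e ε := by
  funext i
  refine Fin.cases rfl (fun i => rfl) i

theorem eval_vecEmpty : (fun i => NTm.eval S e ε (Matrix.vecEmpty i)) = ![] :=
  Subsingleton.elim _ _

theorem eval_zero : NTm.zero.eval S e ε = S.fn .zero ![] := by
  simp only [NTm.zero, NTm.eval, FTm.eval, eval_vecEmpty]

theorem eval_succ (t : NTm) : t.succ.eval S e ε = S.fn .succ ![t.eval S e ε] := by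
  simp only [NTm.succ, NTm.eval, FTm.eval, eval_vecCons, eval_vecEmpty]

theorem eval_add (s t : NTm) :
    (s.add t).eval S e ε = S.fn .add ![t.eval S e ε, s.eval S e ε] := by
  simp only [NTm.add, NTm.eval, FTm.eval, eval_vecCons, eval_vecEmpty]

theorem eval_mul (s t : NTm) :
    (s.mul t).eval S e ε = S.fn .mul ![t.eval S e ε, s.eval S e ε] := by
  simp only [NTm.mul, NTm.eval, FTm.eval, eval_vecCons, eval_vecEmpty]

end

namespace ArithModel

variable {M : Type} [ArithModel M]

theorem sat_separation {φ : Fml} (h : φ ∈ separation) (e : ℕ → M) (ε : FEnv M) :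
    Sat (str M) e ε φ := by
  cases h with
  | succ_ne_zero t =>
    simp only [Fml.neg, Sat, eval_succ, eval_zero, str, prVal_succ, prVal_zero]
    exact succ_ne_zero _
  | succ_inj s t =>
    simp only [Sat, eval_succ, str, prVal_succ]
    exact add_right_cancel

theorem sat_definingEquations {φ : Fml} (h : φ ∈ definingEquations) (e : ℕ → M) (ε : FEnv M) :
    Sat (str M) e ε φ := by
  cases h with
  | proj i x => exact prVal_proj i _
  | comp f g x => exact prVal_comp f g _
  | prec_zero f g x =>
    simp only [Sat, NTm.eval, FTm.eval, eval_vecCons, eval_zero]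
    simp only [str, prVal_zero, prVal_prec_zero]
  | prec_succ f g y x =>
    simp only [Sat, NTm.eval, FTm.eval, eval_vecCons, eval_succ]
    simp only [str, prVal_succ, prVal_prec_succ, Matrix.cons_val_zero]

/-- By `isDef_sat` the formula defines a predicate of the model whose parameters are the assigned
numbers and the codes of the assigned functions. -/
theorem sat_induction {φ : Fml} (h : φ ∈ induction) (e : ℕ → M) {ε : FEnv M}
    (hε : ε.Ok (str M)) : Sat (str M) e ε φ := by
  obtain ⟨φ⟩ := h
  intro h0 hs
  rw [sat_instN, eval_zero] at h0
  obtain ⟨b, rfl⟩ := exists_fenv hε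
  have hd : IsDef fun v : Fin 1 → M => Sat (str M) (scons (v 0) e) (fenv b) φ := by
    have h := isDef_sat φ (n := 1) (a := scons (fun v => v 0) fun m _ => e m)
      (fun m => by cases m; exacts [.var 0, .const _]) (b := fun k m _ => b k m)
      (fun k m => .const _)
    convert h using 3 with v
    funext m; cases m <;> rfl
  refine fun x => ind (fun x => Sat (str M) (scons x e) (fenv b) φ) ?_ (fun x hx => ?_) x
  · rw [← prVal_zero (M := M) ![]]; exact h0
  · have := hs x hx
    rw [sat_stepN] at this
    rw [show x + 1 = prVal .succ ![x] from (prVal_succ ![x]).symm]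
    exact this

theorem sat_explicitDefinition {φ : Fml} (h : φ ∈ explicitDefinition) (e : ℕ → M) {ε : FEnv M}
    (hε : ε.Ok (str M)) : Sat (str M) e ε φ := by
  obtain ⟨k, t⟩ := h
  obtain ⟨b, rfl⟩ := exists_fenv hε
  obtain ⟨c, _, hc⟩ := exists_code_term e b k t
  intro hn
  refine hn _ ⟨c, rfl⟩ ((sat_alls ..).2 fun v => ?_)
  simp only [Sat, NTm.eval_liftF, ← hc, NTm.eval, FTm.eval, vapp_coe]
  simp [fcons]

theorem sat_extensionality {φ : Fml} (h : φ ∈ extensionality) (e : ℕ → M) (ε : FEnv M) :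
    Sat (str M) e ε φ := by
  obtain ⟨f, g⟩ := h
  intro h
  rw [sat_alls] at h
  funext v
  simpa only [Sat, NTm.eval, vapp_coe] using h v

theorem sat_of_provable {φ : Fml} (h : Provable langPRAStar (axPRAStar ∪ extensionality) φ)
    (e : ℕ → M) {ε : FEnv M} (hε : ε.Ok (str M)) : Sat (str M) e ε φ := by
  refine soundness (S := str M) (fun c => ⟨prCode c, rfl⟩)
    (fun k => ⟨constCode 0, funext fun v => ((tot_const 0).2 _).symm⟩) ?_ h e ε hε
  rintro ψ ((((hψ | hψ) | hψ) | hψ) | hψ) e ε hε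
  · exact sat_separation hψ e ε
  · exact sat_definingEquations hψ e ε
  · exact sat_induction hψ e hε
  · exact sat_explicitDefinition hψ e hε
  · exact sat_extensionality hψ e ε

theorem prVal_add (x y : M) : prVal PR.add ![y, x] = x + y := by
  -- The predicate is spelled out with `dec` and `pair` so that its definability is found by
  -- instance search; the right side unfolds to `prVal`.
  refine (ind (fun y => x + y = dec (prCode PR.add) (pair y (pair x 0))) ?_ (fun y hy => ?_) y).symm
  · exact ((prVal_prec_zero (.proj 0) (.comp .succ ![.proj 1]) ![x]).trans
      (by rw [prVal_proj]; simp)).symm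
  · have h := prVal_prec_succ (.proj 0) (.comp .succ ![.proj 1]) y ![x]
    rw [prVal_comp, prVal_succ] at h
    simp only [Matrix.cons_val_zero, prVal_proj] at h
    refine Eq.trans ?_ h.symm
    rw [← add_assoc, hy]; rfl

theorem prVal_mul (x y : M) : prVal PR.mul ![y, x] = x * y := by
  refine (ind (fun y => x * y = dec (prCode PR.mul) (pair y (pair x 0))) ?_ (fun y hy => ?_) y).symm
  · exact ((prVal_prec_zero (.comp .zero ![]) (.comp PR.add ![.proj 2, .proj 1]) ![x]).trans
      (by rw [prVal_comp, prVal_zero, mul_zero])).symm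
  · have h := prVal_prec_succ (.comp .zero ![]) (.comp PR.add ![.proj 2, .proj 1]) y ![x]
    rw [prVal_comp] at h
    have e : ∀ v : Fin 3 → M, (fun i => prVal ((![.proj 2, .proj 1] : Fin 2 → PR 3) i) v) =
        ![v 2, v 1] := by
      intro v; funext i; fin_cases i <;> exact prVal_proj _ _
    rw [e, prVal_add] at h
    refine Eq.trans ?_ h.symm
    rw [mul_add, mul_one, hy]; rfl

end ArithModel

/-! ### Structures that satisfy the axioms of Peano arithmetic -/

/-- The structure satisfies the axioms of Peano arithmetic, with induction for the formulas of
the first-order language `L`. -/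
structure PAStr (L : Lang) {M : Type} (S : Str M) : Prop where
  not_higher : ¬ L.higher
  symbols : ∀ {k : ℕ} (c : PR k), SymbolPA c → L.fn c
  succ_ne_zero : ∀ x, S.fn .succ ![x] ≠ S.fn .zero ![]
  succ_inj : ∀ x y, S.fn .succ ![x] = S.fn .succ ![y] → x = y
  add_zero : ∀ x, S.fn .add ![S.fn .zero ![], x] = x
  add_succ : ∀ x y, S.fn .add ![S.fn .succ ![y], x] = S.fn .succ ![S.fn .add ![y, x]]
  mul_zero : ∀ x, S.fn .mul ![S.fn .zero ![], x] = S.fn .zero ![]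
  mul_succ : ∀ x y, S.fn .mul ![S.fn .succ ![y], x] = S.fn .add ![x, S.fn .mul ![y, x]]
  ind : ∀ φ : Fml, φ.InLang L → ∀ e ε, Sat S (scons (S.fn .zero ![]) e) ε φ →
    (∀ x, Sat S (scons x e) ε φ → Sat S (scons (S.fn .succ ![x]) e) ε φ) →
    ∀ x, Sat S (scons x e) ε φ

theorem vapp_cons {M : Type} {n : ℕ} (x : M) (v : Fin n → M) (p : ℕ → M) :
    vapp (Fin.cons x v : Fin (n + 1) → M) p = scons x (vapp v p) := by
  funext m
  cases m with
  | zero => rfl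
  | succ m =>
    by_cases h : m < n
    · simp only [vapp, scons, h, dif_pos, Nat.succ_lt_succ h]; rfl
    · simp only [vapp, scons, h, dif_neg, mt Nat.lt_of_succ_lt_succ h, not_false_iff]
      congr 1; omega

namespace PAStr

variable {L : Lang} {M : Type} {S : Str M}

theorem zero_inLang (h : PAStr L S) : NTm.zero.InLang L := ⟨h.symbols _ .zero, fun i => i.elim0⟩

theorem succ_inLang (h : PAStr L S) {t : NTm} (ht : t.InLang L) : t.succ.InLang L :=
  ⟨h.symbols _ .succ, fun i => by fin_cases i; exact ht⟩

theorem add_inLang (h : PAStr L S) {s t : NTm} (hs : s.InLang L) (ht : t.InLang L) :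
    (s.add t).InLang L :=
  ⟨h.symbols _ .add, fun i => by fin_cases i; exacts [ht, hs]⟩

theorem mul_inLang (h : PAStr L S) {s t : NTm} (hs : s.InLang L) (ht : t.InLang L) :
    (s.mul t).InLang L :=
  ⟨h.symbols _ .mul, fun i => by fin_cases i; exacts [ht, hs]⟩

end PAStr
end Arith

namespace Arith
namespace PAStr

/-! ### Semiring laws from first-order induction -/

variable {L : Lang} {M : Type} {S : Str M}

/-- Induction for equations, the form in which the semiring laws are proved. The recursion argument
comes first in the identifiers, so `S.fn .add ![y, x]` stands for `x + y`; variable `0` carries the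
induction. -/
theorem ind_eq (h : PAStr L S) (s t : NTm) (hs : s.InLang L) (ht : t.InLang L) (e : ℕ → M)
    (h0 : s.eval S (scons (S.fn .zero ![]) e) (fun k _ => S.fnl k) =
      t.eval S (scons (S.fn .zero ![]) e) (fun k _ => S.fnl k))
    (hx : ∀ x, s.eval S (scons x e) (fun k _ => S.fnl k) =
        t.eval S (scons x e) (fun k _ => S.fnl k) →
      s.eval S (scons (S.fn .succ ![x]) e) (fun k _ => S.fnl k) =
        t.eval S (scons (S.fn .succ ![x]) e) (fun k _ => S.fnl k)) (x : M) :
    s.eval S (scons x e) (fun k _ => S.fnl k) = t.eval S (scons x e) (fun k _ => S.fnl k) :=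
  h.ind (.eq s t) ⟨hs, ht⟩ e _ h0 hx x

theorem zero_add (h : PAStr L S) (x : M) : S.fn .add ![x, S.fn .zero ![]] = x := by
  have := h.ind_eq (.add .zero (.var 0)) (.var 0) (h.add_inLang h.zero_inLang trivial) trivial
    (fun _ => S.fn .zero ![])
  simp only [eval_add, eval_zero, NTm.eval, scons] at this
  refine this (h.add_zero _) (fun x hx => ?_) x
  rw [h.add_succ, hx]

theorem succ_add (h : PAStr L S) (x y : M) :
    S.fn .add ![y, S.fn .succ ![x]] = S.fn .succ ![S.fn .add ![y, x]] := by
  have := h.ind_eq (.add (.succ (.var 1)) (.var 0)) (.succ (.add (.var 1) (.var 0)))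
    (h.add_inLang (h.succ_inLang trivial) trivial) (h.succ_inLang (h.add_inLang trivial trivial))
    (fun _ => x)
  simp only [eval_add, eval_succ, NTm.eval, scons] at this
  refine this ?_ (fun y hy => ?_) y
  · rw [h.add_zero, h.add_zero]
  · rw [h.add_succ, hy, h.add_succ]

theorem add_comm (h : PAStr L S) (x y : M) : S.fn .add ![y, x] = S.fn .add ![x, y] := by
  have := h.ind_eq (.add (.var 1) (.var 0)) (.add (.var 0) (.var 1))
    (h.add_inLang trivial trivial) (h.add_inLang trivial trivial) (fun _ => x)
  simp only [eval_add, NTm.eval, scons] at this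
  refine this ?_ (fun y hy => ?_) y
  · rw [h.add_zero, h.zero_add]
  · rw [h.add_succ, hy, h.succ_add]

theorem add_assoc (h : PAStr L S) (x y z : M) :
    S.fn .add ![z, S.fn .add ![y, x]] = S.fn .add ![S.fn .add ![z, y], x] := by
  have := h.ind_eq (.add (.add (.var 1) (.var 2)) (.var 0)) (.add (.var 1) (.add (.var 2) (.var 0)))
    (h.add_inLang (h.add_inLang trivial trivial) trivial)
    (h.add_inLang trivial (h.add_inLang trivial trivial)) (scons x fun _ => y)
  simp only [eval_add, NTm.eval, scons] at this
  refine this ?_ (fun z hz => ?_) z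
  · rw [h.add_zero, h.add_zero]
  · rw [h.add_succ, hz, h.add_succ, h.add_succ]

theorem zero_mul (h : PAStr L S) (x : M) : S.fn .mul ![x, S.fn .zero ![]] = S.fn .zero ![] := by
  have := h.ind_eq (.mul .zero (.var 0)) .zero (h.mul_inLang h.zero_inLang trivial) h.zero_inLang
    (fun _ => S.fn .zero ![])
  simp only [eval_mul, eval_zero, NTm.eval, scons] at this
  refine this (h.mul_zero _) (fun x hx => ?_) x
  rw [h.mul_succ, hx, h.add_zero]

theorem succ_mul (h : PAStr L S) (x y : M) :
    S.fn .mul ![y, S.fn .succ ![x]] = S.fn .add ![y, S.fn .mul ![y, x]] := by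
  have := h.ind_eq (.mul (.succ (.var 1)) (.var 0)) (.add (.mul (.var 1) (.var 0)) (.var 0))
    (h.mul_inLang (h.succ_inLang trivial) trivial)
    (h.add_inLang (h.mul_inLang trivial trivial) trivial) (fun _ => x)
  simp only [eval_add, eval_mul, eval_succ, NTm.eval, scons] at this
  refine this ?_ (fun y hy => ?_) y
  · rw [h.mul_zero, h.mul_zero, h.add_zero]
  · rw [h.mul_succ, hy, h.mul_succ, h.add_succ, h.add_succ, h.add_assoc, h.add_assoc,
      h.add_comm x y]

theorem mul_comm (h : PAStr L S) (x y : M) : S.fn .mul ![y, x] = S.fn .mul ![x, y] := by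
  have := h.ind_eq (.mul (.var 1) (.var 0)) (.mul (.var 0) (.var 1))
    (h.mul_inLang trivial trivial) (h.mul_inLang trivial trivial) (fun _ => x)
  simp only [eval_mul, NTm.eval, scons] at this
  refine this ?_ (fun y hy => ?_) y
  · rw [h.mul_zero, h.zero_mul]
  · rw [h.mul_succ, hy, h.succ_mul]

theorem mul_add (h : PAStr L S) (x y z : M) :
    S.fn .mul ![S.fn .add ![z, y], x] = S.fn .add ![S.fn .mul ![z, x], S.fn .mul ![y, x]] := by
  have := h.ind_eq (.mul (.var 1) (.add (.var 2) (.var 0)))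
    (.add (.mul (.var 1) (.var 2)) (.mul (.var 1) (.var 0)))
    (h.mul_inLang trivial (h.add_inLang trivial trivial))
    (h.add_inLang (h.mul_inLang trivial trivial) (h.mul_inLang trivial trivial))
    (scons x fun _ => y)
  simp only [eval_add, eval_mul, NTm.eval, scons] at this
  refine this ?_ (fun z hz => ?_) z
  · rw [h.add_zero, h.mul_zero, h.add_zero]
  · rw [h.add_succ, h.mul_succ, hz, h.mul_succ, h.add_assoc]

theorem mul_assoc (h : PAStr L S) (x y z : M) :
    S.fn .mul ![z, S.fn .mul ![y, x]] = S.fn .mul ![S.fn .mul ![z, y], x] := by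
  have := h.ind_eq (.mul (.mul (.var 1) (.var 2)) (.var 0)) (.mul (.var 1) (.mul (.var 2) (.var 0)))
    (h.mul_inLang (h.mul_inLang trivial trivial) trivial)
    (h.mul_inLang trivial (h.mul_inLang trivial trivial)) (scons x fun _ => y)
  simp only [eval_mul, NTm.eval, scons] at this
  refine this ?_ (fun z hz => ?_) z
  · rw [h.mul_zero, h.mul_zero, h.mul_zero]
  · rw [h.mul_succ, hz, h.mul_succ, h.mul_add]

theorem add_one (h : PAStr L S) (x : M) :
    S.fn .add ![S.fn .succ ![S.fn .zero ![]], x] = S.fn .succ ![x] := by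
  rw [h.add_succ, h.add_zero]

theorem mul_one (h : PAStr L S) (x : M) :
    S.fn .mul ![S.fn .succ ![S.fn .zero ![]], x] = x := by
  rw [h.mul_succ, h.mul_zero, h.add_comm, h.add_zero]

theorem add_right_cancel (h : PAStr L S) (x y z : M) :
    S.fn .add ![z, x] = S.fn .add ![z, y] → x = y := by
  have := h.ind (.imp (.eq (.add (.var 1) (.var 0)) (.add (.var 2) (.var 0)))
    (.eq (.var 1) (.var 2)))
    ⟨⟨h.add_inLang trivial trivial, h.add_inLang trivial trivial⟩, trivial, trivial⟩
    (scons x fun _ => y) (fun k _ => S.fnl k)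
  simp only [Sat, eval_add, NTm.eval, scons] at this
  refine this ?_ (fun z hz => ?_) z
  · rw [h.add_zero, h.add_zero]; exact id
  · rw [h.add_succ, h.add_succ]
    exact fun he => hz (h.succ_inj _ _ he)

/-- The semiring of a model of Peano arithmetic. -/
abbrev semiring (h : PAStr L S) : CommSemiring M where
  add x y := S.fn .add ![y, x]
  mul x y := S.fn .mul ![y, x]
  zero := S.fn .zero ![]
  one := S.fn .succ ![S.fn .zero ![]]
  nsmul := @nsmulRec M ⟨S.fn .zero ![]⟩ ⟨fun x y => S.fn .add ![y, x]⟩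
  npow := @npowRec M ⟨S.fn .succ ![S.fn .zero ![]]⟩ ⟨fun x y => S.fn .mul ![y, x]⟩
  add_assoc := h.add_assoc
  zero_add := h.zero_add
  add_zero := h.add_zero
  add_comm := h.add_comm
  left_distrib x y z := h.mul_add x y z
  right_distrib x y z := by
    change S.fn .mul ![z, S.fn .add ![y, x]] = S.fn .add ![S.fn .mul ![z, y], S.fn .mul ![z, x]]
    rw [h.mul_comm, h.mul_add, h.mul_comm z, h.mul_comm z]
  zero_mul := h.zero_mul
  mul_zero := h.mul_zero
  mul_assoc := h.mul_assoc
  one_mul x := (h.mul_comm _ _).trans (h.mul_one x)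
  mul_one := h.mul_one
  mul_comm := h.mul_comm

/-! ### From definability by formulas to a model of arithmetic -/

/-- Definability by a formula of `L`, with the parameters `p`. -/
def Def (L : Lang) (S : Str M) (p : ℕ → M) {n : ℕ} (P : (Fin n → M) → Prop) : Prop :=
  ∃ φ : Fml, φ.InLang L ∧ ∀ v, P v ↔ Sat S (vapp v p) (fun k _ => S.fnl k) φ

/-- Since `p` enumerates the whole carrier, any constant is the value of a variable beyond the first
`n`. This is where countability of the model enters. -/
theorem exists_term (h : PAStr L S) {p : ℕ → M} (hp : Function.Surjective p) {n : ℕ}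
    {f : (Fin n → M) → M} (hf : @IsPoly M h.semiring n f) :
    ∃ t : NTm, t.InLang L ∧ ∀ v, f v = t.eval S (vapp v p) fun k _ => S.fnl k := by
  induction hf with
  | var i => exact ⟨.var i, trivial, fun v => (vapp_coe v p i).symm⟩
  | const c =>
    obtain ⟨j, rfl⟩ := hp c
    exact ⟨.var (n + j), trivial, fun v => by simp [NTm.eval, vapp]⟩
  | add _ _ h₁ h₂ =>
    obtain ⟨s, hs, hs'⟩ := h₁
    obtain ⟨t, ht, ht'⟩ := h₂
    exact ⟨s.add t, h.add_inLang hs ht, fun v => by rw [eval_add, ← hs', ← ht']; rfl⟩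
  | mul _ _ h₁ h₂ =>
    obtain ⟨s, hs, hs'⟩ := h₁
    obtain ⟨t, ht, ht'⟩ := h₂
    exact ⟨s.mul t, h.mul_inLang hs ht, fun v => by rw [eval_mul, ← hs', ← ht']; rfl⟩

/-- A countable structure that satisfies the axioms of Peano arithmetic, as a model of
arithmetic. -/
abbrev model (h : PAStr L S) (p : ℕ → M) (hp : Function.Surjective p) : ArithModel M where
  toCommSemiring := h.semiring
  Def := Def L S p
  def_eq hf hg := by
    obtain ⟨s, hs, hs'⟩ := h.exists_term hp hf
    obtain ⟨t, ht, ht'⟩ := h.exists_term hp hg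
    exact ⟨.eq s t, ⟨hs, ht⟩, fun v => by simp only [hs', ht', Sat]⟩
  def_imp := by
    rintro n P Q ⟨φ, hφ, hP⟩ ⟨ψ, hψ, hQ⟩
    exact ⟨.imp φ ψ, ⟨hφ, hψ⟩, fun v => by simp only [hP, hQ, Sat]⟩
  def_all := by
    rintro n P ⟨φ, hφ, hP⟩
    exact ⟨.all φ, hφ, fun v => by simp only [hP, vapp_cons, Sat]⟩
  def_comp := by
    rintro k n P f ⟨φ, hφ, hP⟩ hf
    choose t ht hft using fun i => h.exists_term hp (hf i)
    -- Parameter variables move from index `k + i` to `n + i`, so they keep their values.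
    refine ⟨φ.subst (fun j => if hj : j < k then t ⟨j, hj⟩ else .var (n + (j - k))) FTm.var,
      Fml.subst_inLang h.not_higher (fun j => ?_) hφ, fun v => ?_⟩
    · split_ifs
      exacts [ht _, trivial]
    · refine (hP _).trans ?_
      rw [sat_subst]
      refine iff_of_eq (congrArg (fun a => Sat S a _ φ) ?_)
      funext j
      by_cases hj : j < k
      · simp [vapp, hj, hft]
      · simp [vapp, hj, NTm.eval]
  ind' := by
    rintro P ⟨φ, hφ, hP⟩ h0 hs x
    have e : ∀ x, P x ↔ Sat S (scons x p) (fun k _ => S.fnl k) φ := fun x => by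
      have : vapp (Fin.cons x Fin.elim0 : Fin 1 → M) p = scons x p := by
        rw [vapp_cons]; congr 1
      rw [← this]
      exact hP (Fin.cons x Fin.elim0)
    rw [e]
    refine h.ind φ hφ p _ ((e _).1 h0) (fun x hx => (e _).1 ?_) x
    rw [← h.add_one]
    exact hs x ((e x).2 hx)
  succ_ne_zero' x := by
    change S.fn .add ![S.fn .succ ![S.fn .zero ![]], x] ≠ S.fn .zero ![]
    rw [h.add_one]
    exact h.succ_ne_zero x
  add_right_cancel' := h.add_right_cancel

theorem isDef_fn (h : PAStr L S) {p : ℕ → M} (hp : Function.Surjective p) {k n : ℕ} {c : PR k}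
    (hc : L.fn c) {f : Fin k → (Fin n → M) → M} {g : (Fin n → M) → M} :
    letI := h.model p hp
    (∀ i, IsPoly (f i)) → IsPoly g → IsDef fun v => g v = S.fn c fun i => f i v := by
  intro hf hg
  let := h.model p hp
  choose t ht hft using fun i => h.exists_term hp (hf i)
  obtain ⟨s, hs, hgs⟩ := h.exists_term hp hg
  exact ⟨.eq s (.app (.pr c) t), ⟨hs, hc, ht⟩, fun v => by
    simp only [hft, hgs, Sat, NTm.eval, FTm.eval]⟩

theorem fn_symbol (h : PAStr L S) {p : ℕ → M} (hp : Function.Surjective p) {k : ℕ} {c : PR k}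
    (hc : SymbolPA c) : (letI := h.model p hp; ArithModel.str M).fn c = S.fn c := by
  let := h.model p hp
  funext v
  cases hc with
  | zero =>
    rw [show v = ![] from Subsingleton.elim _ _]
    exact ArithModel.prVal_zero _
  | succ =>
    rw [show v = ![v 0] from List.ofFn_inj.1 rfl]
    exact (ArithModel.prVal_succ _).trans (h.add_one _)
  | add =>
    rw [show v = ![v 0, v 1] from List.ofFn_inj.1 rfl]
    exact ArithModel.prVal_add _ _
  | mul =>
    rw [show v = ![v 0, v 1] from List.ofFn_inj.1 rfl]
    exact ArithModel.prVal_mul _ _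

/-! ### Uniqueness of the primitive recursive functions -/

/-- The structure interprets the identifiers by functions that satisfy their defining
equations. -/
structure Recursive (S : Str M) : Prop where
  proj : ∀ {n : ℕ} (i : Fin n) (v : Fin n → M), S.fn (.proj i) v = v i
  comp : ∀ {m n : ℕ} (f : PR m) (g : Fin m → PR n) (v : Fin n → M),
    S.fn (.comp f g) v = S.fn f fun i => S.fn (g i) v
  prec_zero : ∀ {n : ℕ} (f : PR n) (g : PR (n + 2)) (v : Fin n → M),
    S.fn (.prec f g) (Matrix.vecCons (S.fn .zero ![]) v) = S.fn f v
  prec_succ : ∀ {n : ℕ} (f : PR n) (g : PR (n + 2)) (y : M) (v : Fin n → M),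
    S.fn (.prec f g) (Matrix.vecCons (S.fn .succ ![y]) v) =
      S.fn g (Matrix.vecCons y (Matrix.vecCons (S.fn (.prec f g) (Matrix.vecCons y v)) v))

/-- The defining equations determine the primitive recursive functions. -/
theorem fn_eq (h : PAStr L S) {p : ℕ → M} (hp : Function.Surjective p) (hr : Recursive S)
    (hL : ∀ {k : ℕ} (c : PR k), L.fn c) {k : ℕ} (c : PR k) :
    (letI := h.model p hp; ArithModel.str M).fn c = S.fn c := by
  let := h.model p hp
  induction c with
  | zero => exact h.fn_symbol hp .zero
  | succ => exact h.fn_symbol hp .succ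
  | proj i => exact funext fun v => (ArithModel.prVal_proj i v).trans (hr.proj i v).symm
  | comp f g ihf ihg =>
    funext v
    refine (ArithModel.prVal_comp f g v).trans ((hr.comp f g v).trans ?_).symm
    rw [← ihf]
    simp only [← ihg]
    rfl
  | @prec n f g ihf ihg =>
    have key : ∀ (v : Fin n → M) (y : M), ArithModel.prVal (.prec f g) (Matrix.vecCons y v) =
        S.fn (.prec f g) (Matrix.vecCons y v) := by
      intro v y
      have hd : IsDef fun w : Fin 1 → M => ArithModel.prVal (.prec f g) (Matrix.vecCons (w 0) v) =
          S.fn (.prec f g) (Matrix.vecCons (w 0) v) := by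
        -- The two sides are definable for different reasons, one by a formula of `L` that contains
        -- the identifier, the other by codes. They are joined through their common value `z`.
        have h1 : IsDef fun w : Fin 2 → M =>
            w 0 = S.fn (.prec f g) fun i => (Fin.cons (w (Fin.succ 0)) v : Fin (n + 1) → M) i :=
          h.isDef_fn hp (hL _) (f := fun i w => (Fin.cons (w (Fin.succ 0)) v : Fin (n + 1) → M) i)
            (fun i => by
              refine Fin.cases ?_ (fun i => ?_) i
              · exact .var _
              · exact .const (v i)) (.var 0)
        have h2 : IsDef fun w : Fin 2 → M => w 0 = ArithModel.dec
            (ArithModel.prCode (.prec f g)) (ArithModel.pair (w (Fin.succ 0)) (ArithModel.tup v)) :=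
          inferInstance
        have h3 : IsDef fun w : Fin 1 → M => ∃ z,
            (z = S.fn (.prec f g) fun i => (Fin.cons (w 0) v : Fin (n + 1) → M) i) ∧
            z = ArithModel.dec
            (ArithModel.prCode (.prec f g)) (ArithModel.pair (w 0) (ArithModel.tup v)) :=
          inferInstance
        convert h3 using 3 with w
        simp only [exists_eq_left]
        exact eq_comm
      refine ArithModel.ind (fun y => ArithModel.prVal (.prec f g) (Matrix.vecCons y v) =
        S.fn (.prec f g) (Matrix.vecCons y v)) ?_ (fun y hy => ?_) y
      · refine (ArithModel.prVal_prec_zero f g v).trans ((hr.prec_zero f g v).trans ?_).symm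
        rw [← ihf]; rfl
      · refine (ArithModel.prVal_prec_succ f g y v).trans ?_
        have e : y + 1 = S.fn .succ ![y] := h.add_one y
        rw [e, hr.prec_succ, ← hy, ← ihg]; rfl
    funext v
    rw [show v = Matrix.vecCons (v 0) (fun i => v i.succ) from (Fin.cons_self_tail v).symm]
    exact key _ _

end PAStr
end Arith

namespace Arith

/-! ### Conservativity -/

variable {L : Lang} {M : Type} {S : Str M} {Ax : Set Fml}

theorem PAStr.of_axioms (hL : ¬ L.higher) (hsym : ∀ {k : ℕ} (c : PR k), SymbolPA c → L.fn c)
    (hAx : separation ∪ induction ⊆ Ax)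
    (hadd : ∀ φ ∈ addMulEquations, φ.InLang L → ∀ e ε, Sat S e ε φ)
    (hS : ∀ φ ∈ Ax, φ.InLang L → ∀ e ε, Sat S e ε φ) : PAStr L S := by
  have ez : NTm.zero.InLang L := ⟨hsym _ .zero, fun i => i.elim0⟩
  have es : ∀ {t : NTm}, t.InLang L → t.succ.InLang L := fun ht =>
    ⟨hsym _ .succ, fun i => by fin_cases i; exact ht⟩
  have ea : ∀ {s t : NTm}, s.InLang L → t.InLang L → (s.add t).InLang L := fun hs ht =>
    ⟨hsym _ .add, fun i => by fin_cases i; exacts [ht, hs]⟩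
  have em : ∀ {s t : NTm}, s.InLang L → t.InLang L → (s.mul t).InLang L := fun hs ht =>
    ⟨hsym _ .mul, fun i => by fin_cases i; exacts [ht, hs]⟩
  have v : ∀ n, (NTm.var n).InLang L := NTm.var_inLang
  refine ⟨hL, hsym, fun x => ?_, fun x y => ?_, fun x => ?_, fun x y => ?_, fun x => ?_,
    fun x y => ?_, fun φ hφ e ε h0 hs => ?_⟩
  · simpa only [Fml.neg, Sat, ne_eq, Not, eval_succ, eval_zero, NTm.eval, scons] using
      hS _ (hAx (.inl (.succ_ne_zero (.var 0)))) ⟨⟨es (v 0), ez⟩, trivial⟩ (fun _ => x)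
        (fun k _ => S.fnl k)
  · simpa only [Sat, eval_succ, NTm.eval, scons] using
      hS _ (hAx (.inl (.succ_inj (.var 0) (.var 1)))) ⟨⟨es (v 0), es (v 1)⟩, v 0, v 1⟩
        (scons x fun _ => y) (fun k _ => S.fnl k)
  · simpa only [Sat, eval_add, eval_zero, NTm.eval, scons] using
      hadd _ (.add_zero (.var 0)) ⟨ea (v 0) ez, v 0⟩ (fun _ => x) (fun k _ => S.fnl k)
  · simpa only [Sat, eval_add, eval_succ, NTm.eval, scons] using
      hadd _ (.add_succ (.var 0) (.var 1)) ⟨ea (v 0) (es (v 1)), es (ea (v 0) (v 1))⟩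
        (scons x fun _ => y) (fun k _ => S.fnl k)
  · simpa only [Sat, eval_mul, eval_zero, NTm.eval, scons] using
      hadd _ (.mul_zero (.var 0)) ⟨em (v 0) ez, ez⟩ (fun _ => x) (fun k _ => S.fnl k)
  · simpa only [Sat, eval_mul, eval_add, eval_succ, NTm.eval, scons] using
      hadd _ (.mul_succ (.var 0) (.var 1)) ⟨em (v 0) (es (v 1)), ea (em (v 0) (v 1)) (v 0)⟩
        (scons x fun _ => y) (fun k _ => S.fnl k)
  · have hi : (φ.instN .zero).InLang L := by
      rw [instN_eq]
      exact Fml.subst_inLang hL (scons_inLang v ez) hφ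
    have hst : φ.stepN.InLang L := by
      refine Fml.subst_inLang hL (fun n => ?_) hφ
      cases n with
      | zero => exact es (v 0)
      | succ n => exact v (n + 1)
    refine hS _ (hAx (.inr ⟨φ⟩)) ⟨hi, ⟨hφ, hst⟩, hφ⟩ e ε ?_ fun x hx => (sat_stepN ..).2 (hs x hx)
    rw [sat_instN, eval_zero]
    exact h0

/-- A formula that is provable in the extended theory holds in every countable structure that
satisfies the axioms of Peano arithmetic and interprets the identifiers of the formula as
primitive recursive functions. -/
theorem sat_of_pAStr {N : Lang} (hN : ¬ N.higher) [Countable M] (h : PAStr L S)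
    (hfn : ∀ (p : ℕ → M) (hp : Function.Surjective p) {k : ℕ} (c : PR k), N.fn c →
      (letI := h.model p hp; ArithModel.str M).fn c = S.fn c)
    {φ : Fml} (hφ : φ.InLang N) (hp : Provable langPRAStar (axPRAStar ∪ extensionality) φ)
    (e : ℕ → M) (ε : FEnv M) : Sat S e ε φ := by
  have : Nonempty M := ⟨e 0⟩
  obtain ⟨p, hps⟩ := exists_surjective_nat M
  let := h.model p hps
  -- Truth of a formula of `N` is the same in both structures and does not depend on the assigned
  -- functions, so an admissible assignment, constantly zero, replaces `ε`.
  refine (sat_congr hN (fun c => hfn p hps c) (fun k _ => (ArithModel.str M).fnl k) ε φ hφ e).1 ?_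
  exact ArithModel.sat_of_provable hp e fun k n => ⟨ArithModel.constCode 0,
    funext fun v => ((ArithModel.tot_const 0).2 _).symm⟩

theorem conservative_PA {φ : Fml} (hφ : φ.InLang langPA)
    (hp : Provable langPRAStar (axPRAStar ∪ extensionality) φ) : ProvablePA φ := by
  have hL : ¬ langPA.higher := id
  refine completeness hL hφ fun M _ S hS e ε => ?_
  have h : PAStr langPA S := PAStr.of_axioms (Ax := axPA) hL (fun c hc => hc)
    (by unfold axPA; intro ψ hψ; simp only [Set.mem_union] at hψ ⊢; tauto)
    (fun ψ hψ => hS ψ (.inl (.inr hψ))) hS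
  exact sat_of_pAStr hL h (fun p hp _ c hc => h.fn_symbol hp hc) hφ hp e ε

theorem recursive_of_axioms (hS : ∀ φ ∈ axPRA, φ.InLang langPRA → ∀ e ε, Sat S e ε φ) :
    PAStr.Recursive S := by
  have hd : ∀ φ ∈ definingEquations, φ.InLang langPRA → ∀ e ε, Sat S e ε φ :=
    fun ψ hψ => hS ψ (.inl (.inr hψ))
  have hv : ∀ {n : ℕ} (y : NTm) (_ : y.InLang langPRA) (x : Fin n → NTm)
      (_ : ∀ i, (x i).InLang langPRA) (i : Fin (n + 1)),
      (Matrix.vecCons y x i).InLang langPRA := fun y hy x hx i =>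
    Fin.cases hy hx i
  have hz : NTm.zero.InLang langPRA := ⟨trivial, fun i => i.elim0⟩
  have hs : ∀ n, (NTm.var n).succ.InLang langPRA := fun n =>
    ⟨trivial, fun i => by fin_cases i; trivial⟩
  constructor
  · intro n i v
    have := hd _ (.proj i fun i => .var i) ⟨⟨trivial, fun _ => trivial⟩, trivial⟩
      (vapp v fun _ => S.fn .zero ![]) (fun k _ => S.fnl k)
    simpa only [Sat, NTm.eval, FTm.eval, vapp_coe] using this
  · intro m n f g v
    have := hd _ (.comp f g fun i => .var i)
      ⟨⟨trivial, fun _ => trivial⟩, trivial, fun _ => ⟨trivial, fun _ => trivial⟩⟩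
      (vapp v fun _ => S.fn .zero ![]) (fun k _ => S.fnl k)
    simpa only [Sat, NTm.eval, FTm.eval, vapp_coe] using this
  · intro n f g v
    have := hd _ (.prec_zero f g fun i => .var i)
      ⟨⟨trivial, hv _ hz _ fun _ => trivial⟩, trivial, fun _ => trivial⟩
      (vapp v fun _ => S.fn .zero ![]) (fun k _ => S.fnl k)
    simpa only [Sat, NTm.eval, FTm.eval, vapp_coe, eval_vecCons, eval_zero] using this
  · intro n f g y v
    have := hd _ (.prec_succ f g (.var n) fun i => .var i)
      ⟨⟨trivial, hv _ (hs n) _ fun _ => trivial⟩, trivial, hv _ (NTm.var_inLang n) _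
        (hv (.app (.pr (.prec f g)) (Matrix.vecCons (.var n) fun i => .var i))
          ⟨trivial, hv _ (NTm.var_inLang n) _ fun _ => trivial⟩ _ fun _ => trivial)⟩
      (vapp v fun _ => y) (fun k _ => S.fnl k)
    have hn : vapp v (fun _ => y) n = y := by simp [vapp]
    simpa only [Sat, NTm.eval, FTm.eval, vapp_coe, eval_vecCons, eval_succ, hn] using this

/-- These equations are not axioms of PRA, but they follow from the defining equations of the
identifiers `PR.add` and `PR.mul`. -/
theorem sat_addMulEquations (hr : PAStr.Recursive S) {φ : Fml} (h : φ ∈ addMulEquations)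
    (e : ℕ → M) (ε : FEnv M) : Sat S e ε φ := by
  have h2 : ∀ v : Fin 3 → M, (fun i => S.fn ((![.proj 2, .proj 1] : Fin 2 → PR 3) i) v) =
      ![v 2, v 1] := by
    intro v; funext i; fin_cases i <;> exact hr.proj _ _
  have h1 : ∀ v : Fin 3 → M, (fun i => S.fn ((![.proj 1] : Fin 1 → PR 3) i) v) = ![v 1] := by
    intro v; funext i; fin_cases i; exact hr.proj _ _
  cases h with
  | add_zero s =>
    simp only [Sat, eval_add, eval_zero]
    exact (hr.prec_zero ..).trans (hr.proj ..)
  | add_succ s t =>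
    simp only [Sat, eval_add, eval_succ]
    refine (hr.prec_succ ..).trans ((hr.comp ..).trans ?_)
    rw [h1]; rfl
  | mul_zero s =>
    simp only [Sat, eval_mul, eval_zero]
    refine (hr.prec_zero ..).trans ((hr.comp ..).trans ?_)
    exact congrArg _ (Subsingleton.elim _ _)
  | mul_succ s t =>
    simp only [Sat, eval_mul, eval_succ, eval_add]
    refine (hr.prec_succ ..).trans ((hr.comp ..).trans ?_)
    rw [h2]; rfl

theorem conservative_PRA {φ : Fml} (hφ : φ.InLang langPRA)
    (hp : Provable langPRAStar (axPRAStar ∪ extensionality) φ) : ProvablePRA φ := by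
  have hL : ¬ langPRA.higher := id
  refine completeness hL hφ fun M _ S hS e ε => ?_
  have hr := recursive_of_axioms hS
  have h : PAStr langPRA S := PAStr.of_axioms (Ax := axPRA) hL (fun c _ => trivial)
    (by unfold axPRA; intro ψ hψ; simp only [Set.mem_union] at hψ ⊢; tauto)
    (fun ψ hψ _ e ε => sat_addMulEquations hr hψ e ε) hS
  exact sat_of_pAStr hL h (fun p hp _ c _ => h.fn_eq hp hr (fun _ => trivial) c) hφ hp e ε

end Arith

theorem lemma6p1 :
    (∀ φ : Arith.Fml, φ.InLang Arith.langPRA →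
      Arith.ProvablePRAStar ∅ φ → Arith.ProvablePRA φ) ∧
    (∀ φ : Arith.Fml, φ.InLang Arith.langPA →
      Arith.ProvablePRAStar ∅ φ → Arith.ProvablePA φ) ∧
    (∀ φ : Arith.Fml, φ.InLang Arith.langPRA →
      Arith.ProvablePRAStar Arith.extensionality φ → Arith.ProvablePRA φ) ∧
    (∀ φ : Arith.Fml, φ.InLang Arith.langPA →
      Arith.ProvablePRAStar Arith.extensionality φ → Arith.ProvablePA φ) :=
  ⟨fun _ hφ h => Arith.conservative_PRA hφ
      (h.mono (Set.union_subset_union_right _ (Set.empty_subset _))),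
    fun _ hφ h => Arith.conservative_PA hφ
      (h.mono (Set.union_subset_union_right _ (Set.empty_subset _))),
    fun _ hφ h => Arith.conservative_PRA hφ h, fun _ hφ h => Arith.conservative_PA hφ h⟩
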